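/- **Setting.** Let $y_i=\mathbf x_i^T\beta^*+\epsilon_i$, $i=1,\dots,n$ ($n\ge 1$), where the pairs $(\mathbf x_i,\epsilon_i)\in\mathbb R^p\times\mathbb R$ are i.i.d., $\mathbf x_i$ is independent of $\epsilon_i$, $E[\epsilon_i]=0$ and $E[\mathbf x_i]=0$. The coordinates $\{1,\dots,p\}$ are partitioned into nonempty groups $I_1,\dots,I_J$ of sizes $d_1,\dots,d_J$; $\beta_j$ denotes the sub-vector of $\beta$ on $I_j$. Let $\emptyset\ne S\subseteq\{1,\dots,J\}$ with $\beta^*_j=0$ for $j\notin S$, $I_S=\bigcup_{j\in S}I_j$, $s=|S|$, $k=|I_S|$, $d_a=\max_j d_j$, $d_b=\min_j d_j$, $d=\sqrt{d_a/d_b}$. With measurable weight functions $w,v>0$ let $$\mathcal L_n(\beta)=\frac1n\sum_{i=1}^n\frac{w(\mathbf x_i)}{v(\mathbf x_i)}\,l\big((y_i-\mathbf x_i^T\beta)v(\mathbf x_i)\big).$$ *Loss.* $l:\mathbb R\to\mathbb R$ is differentiable, $l''$ exists almost everywhere, $|l'|\le k_1$, and $l'$ is $k_2$-Lipschitz. *Penalty.*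 $\rho$ is $(\mu,\delta)$-amenable with $\mu,\delta>0$: for all $\lambda>0$, (i) $\rho(t,\cdot)$ is non-decreasing on $(0,\infty)$ for each $t>0$; (ii) $\rho(t,a\lambda)/\rho(t,\lambda)\le g(a)$ for all $a\ge1$, $t>0$, for some function $g$; (iii) $\rho(\cdot,\lambda)$ is even and $\rho(0,\lambda)=0$; (iv) $\rho(\cdot,\lambda)$ is non-decreasing on $(0,\infty)$; (v) $\rho(t,\lambda)/t$ is non-increasing in $t>0$; (vi) $\rho(\cdot,\lambda)$ is differentiable at every $t\neq0$; (vii) $\lim_{t\to0^+}\partial_t\rho(t,\lambda)=\lambda$; (viii) $t\mapsto\rho(t,\lambda)+\frac\mu2t^2$ is convex; (ix) $\partial_t\rho(t,\lambda)=0$ for all $t\ge\delta\lambda$. (MCP and SCAD are examples.) *Design.* Call $Z$ sub-Gaussian with parameter $\sigma^2$ if $E e^{t(Z-EZ)}\le e^{\sigma^2t^2/2}$ for all $t\in\mathbb R$. For every $\nu\in\mathbb R^p$, $w(\mathbf x)\mathbf x^T\nu$ is sub-Gaussian with parameter $k_0^2\|\nu\|_2^2$; for every $m\le p$, $v(\mathbf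 x)x_m$ is sub-Gaussian with parameter $\sigma^2$; $|E[w(\mathbf x)x_m]|\le M$ and $|E[v(\mathbf x)x_m]|\le M$ for all $m$; and either $v\equiv1$ and $E[w(\mathbf x)\mathbf x]=0$, or $E[l'(v(\mathbf x)\epsilon)\mid\mathbf x]=0$. *RSC.* For given $\gamma,\tau,r>0$ with $\frac34\mu<\gamma$, the restricted strong convexity (RSC) condition is: for all $\beta_1,\beta_2$ with $\|\beta_i-\beta^*\|_2\le r$, $$\langle\nabla\mathcal L_n(\beta_1)-\nabla\mathcal L_n(\beta_2),\beta_1-\beta_2\rangle\ge\gamma\|\beta_1-\beta_2\|_2^2-\tau\tfrac{\log p}{n}\|\beta_1-\beta_2\|_1^2 .$$ *Programs.* A stationary point of the program $\min_{\|\beta\|_1\le R}\{\mathcal L_n(\beta)+\sum_j\rho(\|\beta_j\|_2,\sqrt{d_j}\lambda)\}$ is a $\hat\beta$ with $\|\hat\beta\|_1\le R$ for which some generalized gradient $\zeta$ of the penalty at $\hat\beta$ satisfies $\langle\nabla\mathcal L_n(\hat\beta)+\zeta,\beta-\hat\beta\rangle\ge0$ for all $\beta$ near $\hat\beta$ with $\|\beta\|_1\le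 R$. Here $\zeta_j=\partial_t\rho(\|\hat\beta_j\|_2,\sqrt{d_j}\lambda)\,\hat\beta_j/\|\hat\beta_j\|_2$ if $\hat\beta_j\ne0$, and $\|\zeta_j\|_2\le\sqrt{d_j}\lambda$ if $\hat\beta_j=0$. An oracle estimator is a minimizer of $\mathcal L_n$ over $\{\beta:\ \mathrm{supp}(\beta)\subseteq I_S,\ \|\beta-\beta^*\|_2\le r\}$. **Theorem 2.** Fix $k_0,k_1,k_2,\sigma,\mu,\delta,\gamma,\tau,r>0$ with $\frac34\mu<\gamma$, and $M,K\in\mathbb R$. There are positive constants $C_0,C_4,C_7,c_6$, and for every $C_6\ge c_6$ a positive constant $C_8$, depending only on these numbers (and $C_8$ also on $C_6$), such that the following holds in every setting as above. Suppose $n\ge C_0k\log p$, $k^2\log k\le K\log p$, $\lambda=C_6\sqrt{\log p/n}$, $\lambda\ge8\tau R\frac{\log p}n$, $\|\beta^*\|_1\le\frac R2$, $R>\frac{12(1+3g(d))d_a\lambda s}{4\gamma-3\mu}$, and $\min_{j\in S}\|\beta^*_j\|_2\ge C_8\sqrt{d_a\log p/n}$. Then, with probability at least $1-C_7\exp(-C_4\log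 p/k^2)$, the following holds whenever the realized $\mathcal L_n$ satisfies the RSC condition: the oracle estimator $\hat\beta^{\mathcal O}$ exists and is unique, and every stationary point $\hat\beta$ with $\|\hat\beta-\beta^*\|_2\le r$ satisfies $\mathrm{supp}(\hat\beta)\subseteq I_S$ and $\hat\beta_{I_S}=\hat\beta^{\mathcal O}_{I_S}$. -/

import Mathlib

open MeasureTheory ProbabilityTheory Filter Topology

noncomputable section

namespace GroupM

/-- The coefficient space `ℝ^p` with its Euclidean norm. -/
abbrev Vec (p : ℕ) : Type := EuclideanSpace ℝ (Fin p)

/-- The `ℓ₁` norm on `ℝ^p`. -/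
def l1Norm {p : ℕ} (β : Vec p) : ℝ := ∑ m, |β m|

/-! ### Groups. The map `grp` sends every coefficient index to the label of its group. -/

/-- `I_j`: the coefficient indices in group `j`. -/
def groupIndex {p J : ℕ} (grp : Fin p → Fin J) (j : Fin J) : Finset (Fin p) :=
  Finset.univ.filter fun m => grp m = j

/-- `I_S`: the coefficient indices that belong to the groups in `S`. -/
def groupSupport {p J : ℕ} (grp : Fin p → Fin J) (S : Finset (Fin J)) : Finset (Fin p) :=
  Finset.univ.filter fun m => grp m ∈ S

/-- `d_j`: the size of group `j`. -/
def groupSize {p J : ℕ} (grp : Fin p → Fin J) (j : Fin J) : ℕ := (groupIndex grp j).card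

/-- `d_a`: the largest group size. -/
def maxGroupSize {p J : ℕ} (grp : Fin p → Fin J) : ℕ := ⨆ j, groupSize grp j

/-- `d_b`: the smallest group size. -/
def minGroupSize {p J : ℕ} (grp : Fin p → Fin J) : ℕ := ⨅ j, groupSize grp j

/-- `d = √(d_a / d_b)`. -/
def sizeRatio {p J : ℕ} (grp : Fin p → Fin J) : ℝ :=
  Real.sqrt ((maxGroupSize grp : ℝ) / (minGroupSize grp : ℝ))

/-- `‖β_j‖₂`: the Euclidean norm of the sub-vector of `β` in group `j`. -/
def groupNorm {p J : ℕ} (grp : Fin p → Fin J) (β : Vec p) (j : Fin J) : ℝ :=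
  Real.sqrt (∑ m ∈ groupIndex grp j, β m ^ 2)

/-- The penalty level `√d_j · lam` of group `j`. -/
def groupLevel {p J : ℕ} (grp : Fin p → Fin J) (lam : ℝ) (j : Fin J) : ℝ :=
  Real.sqrt (groupSize grp j) * lam

/-! ### Penalty and loss -/

/-- `ρ t lam` is a `μ`-amenable penalty, and `g` is a function that controls its growth in the
tuning parameter. The tuning parameter `lam` ranges over the positive reals. -/
structure IsAmenable (ρ : ℝ → ℝ → ℝ) (g : ℝ → ℝ) (μ : ℝ) : Prop where
  mono_level : ∀ t : ℝ, 0 < t → MonotoneOn (fun lam => ρ t lam) (Set.Ioi 0)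
  ratio_le : ∀ a : ℝ, 1 ≤ a → ∀ t lam : ℝ, 0 < t → 0 < lam → ρ t (a * lam) / ρ t lam ≤ g a
  symm : ∀ lam : ℝ, 0 < lam → ∀ t : ℝ, ρ (-t) lam = ρ t lam
  zero : ∀ lam : ℝ, 0 < lam → ρ 0 lam = 0
  mono : ∀ lam : ℝ, 0 < lam → MonotoneOn (fun t => ρ t lam) (Set.Ioi 0)
  anti_div : ∀ lam : ℝ, 0 < lam → AntitoneOn (fun t => ρ t lam / t) (Set.Ioi 0)
  diff : ∀ lam : ℝ, 0 < lam → ∀ t : ℝ, t ≠ 0 → DifferentiableAt ℝ (fun u => ρ u lam) t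
  deriv_zero : ∀ lam : ℝ, 0 < lam →
    Tendsto (deriv fun u => ρ u lam) (𝓝[>] 0) (𝓝 lam)
  weak_convex : ∀ lam : ℝ, 0 < lam →
    ConvexOn ℝ Set.univ fun t => ρ t lam + μ / 2 * t ^ 2

/-- `ρ` is `(μ, δ)`-amenable: `μ`-amenable, and flat beyond `δ * lam`. -/
structure IsFlatAmenable (ρ : ℝ → ℝ → ℝ) (g : ℝ → ℝ) (μ δ : ℝ) : Prop
    extends IsAmenable ρ g μ where
  flat : ∀ lam : ℝ, 0 < lam → ∀ t : ℝ, δ * lam ≤ t → deriv (fun u => ρ u lam) t = 0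

/-- The residual function `l` has a derivative everywhere and a second derivative almost
everywhere; its derivative is bounded by `k₁` and `k₂`-Lipschitz. -/
structure IsRobustLoss (l : ℝ → ℝ) (k₁ k₂ : ℝ) : Prop where
  diff : Differentiable ℝ l
  diff₂ : ∀ᵐ u : ℝ, DifferentiableAt ℝ (deriv l) u
  bounded : ∀ u : ℝ, |deriv l u| ≤ k₁
  lipschitz : ∀ u u' : ℝ, |deriv l u - deriv l u'| ≤ k₂ * |u - u'|

/-- The weighted empirical loss
`L_n(β) = (1/n) ∑ᵢ (w(xᵢ) / v(xᵢ)) * l ((yᵢ - xᵢᵀ β) * v(xᵢ))`. -/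
def empLoss {n p : ℕ} (w v : Vec p → ℝ) (l : ℝ → ℝ) (x : Fin n → Vec p) (y : Fin n → ℝ)
    (β : Vec p) : ℝ :=
  (1 / (n : ℝ)) * ∑ i, w (x i) / v (x i) * l ((y i - inner ℝ (x i) β) * v (x i))

/-- Local restricted strong convexity of `L` on the ball of radius `r` around `βs`. -/
def RSC {p : ℕ} (n : ℕ) (L : Vec p → ℝ) (βs : Vec p) (γ τ r : ℝ) : Prop :=
  ∀ β₁ β₂ : Vec p, ‖β₁ - βs‖ ≤ r → ‖β₂ - βs‖ ≤ r →
    γ * ‖β₁ - β₂‖ ^ 2 - τ * (Real.log p / n) * l1Norm (β₁ - β₂) ^ 2 ≤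
      inner ℝ (gradient L β₁ - gradient L β₂) (β₁ - β₂)

/-! ### The penalized program and the oracle program -/

/-- `ζ` is a generalized gradient at `β` of the penalty `∑ⱼ ρ(‖β_j‖₂, √d_j lam)`. On a group with
`β_j ≠ 0` it is the gradient; on a group with `β_j = 0` it is any vector of the ball of radius
`√d_j lam`. In other words `ζ = -∇q_lam(β) + lam D z` with `z_j ∈ ∂‖β_j‖₂`. -/
def IsPenaltyGradient {p J : ℕ} (ρ : ℝ → ℝ → ℝ) (grp : Fin p → Fin J) (lam : ℝ)
    (β ζ : Vec p) : Prop :=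
  ∀ j : Fin J,
    (groupNorm grp β j ≠ 0 → ∀ m ∈ groupIndex grp j,
      ζ m = deriv (fun t => ρ t (groupLevel grp lam j)) (groupNorm grp β j) *
        (β m / groupNorm grp β j)) ∧
    (groupNorm grp β j = 0 → groupNorm grp ζ j ≤ groupLevel grp lam j)

/-- `b` is a stationary point of: minimize `L(β) + ∑ⱼ ρ(‖β_j‖₂, √d_j lam)` over `‖β‖₁ ≤ R`. -/
def IsStationary {p J : ℕ} (L : Vec p → ℝ) (ρ : ℝ → ℝ → ℝ) (grp : Fin p → Fin J)
    (lam R : ℝ) (b : Vec p) : Prop :=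
  l1Norm b ≤ R ∧ ∃ ζ : Vec p, IsPenaltyGradient ρ grp lam b ζ ∧
    ∀ᶠ β in 𝓝 b, l1Norm β ≤ R → 0 ≤ inner ℝ (gradient L b + ζ) (β - b)

/-- `b` solves the group-level local oracle program: minimize `L` over the vectors that are
supported on `I` and lie within distance `r` of `βs`. -/
def IsOracle {p : ℕ} (L : Vec p → ℝ) (I : Finset (Fin p)) (βs : Vec p) (r : ℝ)
    (b : Vec p) : Prop :=
  b ∈ {β : Vec p | (∀ m ∉ I, β m = 0) ∧ ‖β - βs‖ ≤ r} ∧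
    IsMinOn L {β : Vec p | (∀ m ∉ I, β m = 0) ∧ ‖β - βs‖ ≤ r} b

/-! ### The random design -/

/-- `Z` is sub-Gaussian with parameter `σ2` (a variance proxy): the centred variable satisfies
`E exp(t (Z - E Z)) ≤ exp(σ2 t² / 2)` for all real `t`. -/
def IsSubGaussian {Ω : Type*} [MeasurableSpace Ω] (P : Measure Ω) (Z : Ω → ℝ) (σ2 : ℝ) : Prop :=
  HasSubgaussianMGF (fun ω => Z ω - ∫ ω', Z ω' ∂P) (Real.toNNReal σ2) P

/-- The pairs (covariate vector, error) are i.i.d., and the covariates are independent of the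
errors. -/
structure IsSample {Ω : Type*} [MeasurableSpace Ω] {n p : ℕ} (P : Measure Ω)
    (X : Fin n → Ω → Vec p) (ε : Fin n → Ω → ℝ) : Prop where
  meas_X : ∀ i, Measurable (X i)
  meas_ε : ∀ i, Measurable (ε i)
  indep : iIndepFun (fun i ω => (X i ω, ε i ω)) P
  ident : ∀ i i', IdentDistrib (fun ω => (X i ω, ε i ω)) (fun ω => (X i' ω, ε i' ω)) P P
  indep_X_ε : ∀ i, IndepFun (X i) (ε i) P

/-- The conditions on one covariate vector `x` and one error `e`, for the weights `w`, `v` and the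
residual function `l`. Here `k₀` and `σ` are the sub-Gaussian scales of `w(x) xᵀν` and `v(x) x_m`,
and `M` bounds the means of `w(x) x_m` and `v(x) x_m`. -/
structure DesignConditions {Ω : Type*} [MeasurableSpace Ω] {p : ℕ} (P : Measure Ω)
    (w v : Vec p → ℝ) (l : ℝ → ℝ) (k₀ σ M : ℝ) (x : Ω → Vec p) (e : Ω → ℝ) : Prop where
  int_error : Integrable e P
  mean_error : ∫ ω, e ω ∂P = 0
  int_cov : ∀ m, Integrable (fun ω => x ω m) P
  mean_cov : ∀ m, ∫ ω, x ω m ∂P = 0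
  subG_w : ∀ ν : Vec p,
    IsSubGaussian P (fun ω => w (x ω) * inner ℝ (x ω) ν) (k₀ ^ 2 * ‖ν‖ ^ 2)
  unbiased :
    ((∀ z, v z = 1) ∧ ∀ m, ∫ ω, w (x ω) * x ω m ∂P = 0) ∨
      P[fun ω => deriv l (v (x ω) * e ω) | MeasurableSpace.comap x inferInstance] =ᵐ[P] 0
  subG_v : ∀ m, IsSubGaussian P (fun ω => v (x ω) * x ω m) (σ ^ 2)
  mean_w_le : ∀ m, |∫ ω, w (x ω) * x ω m ∂P| ≤ M
  mean_v_le : ∀ m, |∫ ω, v (x ω) * x ω m ∂P| ≤ M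

end GroupM

end

/-!
Every stationary point is compared with the oracle estimator directly, in one step.

Write `a = √(log p / n)`, `k = |I_S|`, and let `ν = b - bO` be the difference between a stationary
point `b` in the ball and the oracle estimator `bO`. On the subspace of `I_S` restricted strong
convexity is strong convexity once `n ≥ C₀ k log p`; hence the oracle estimator exists, is unique,
and lies within a multiple of `√k · max_{m ∈ I_S} |∇L(βs)_m|` of the truth. The probability
`1 - C₇ exp (-C₄ log p / k²)` is what it costs to make that maximum of order `a / k`
(the hypothesis `k² log k ≤ K log p` pays for the union bound over `I_S`). The `ℓ₁` error of `bO` is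
then of order `a`, so that

* `bO` is interior to the ball, and `∇L(bO)` vanishes on `I_S`;
* `∇L(bO)` is at most `lam / 8` elsewhere, as the coordinates of `∇L` are Lipschitz for the `ℓ₁`
  norm, with a constant given by the empirical second moments of the weighted covariates
  (`abs_gradient_empLoss_sub_le`);
* by the signal condition `bO` is feasible, and on the groups of `S` it lies at least twice as far
  out as the point where the penalty becomes flat.

The last fact gives the penalty inequality `IsPenaltyGradient.inner_sub_le`: for a generalized
gradient `ζ` at `b`,
`⟨ζ, bO - b⟩ ≤ (μ / 2) ‖ν‖² - (lam / 2) ‖ν‖₁`, the `ℓ₁` norm being taken off `I_S`.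
Together with stationarity and restricted strong convexity this is used twice
(`IsStationary.eq_of_flat`). Bounding the tolerance `τ (log p / n) ‖ν‖₁²` linearly, by
`‖ν‖₁ ≤ 2R` and `8 τ R log p / n ≤ lam`, gives the cone condition
`‖ν off I_S‖₁ ≤ 2 ‖ν on I_S‖₁`; on that cone the tolerance is at most `(μ / 4) ‖ν‖²`, and the same
inequality leaves `(γ - 3 μ / 4) ‖ν‖² ≤ 0`, so `ν = 0`.

For the probability bounds, the square of a sub-Gaussian variable has an exponential moment, and a
centred variable whose square has one is sub-Gaussian (`hasSubgaussianMGF_of_exp_sq`). As `l'` is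
bounded, this makes the coordinates of the score sub-Gaussian, and Hoeffding's inequality applies;
the empirical second moments are controlled by Chernoff's bound (`IsSample.exists_event`).
-/

namespace GroupM

/-! ### The penalty -/

section Penalty

variable {ρ : ℝ → ℝ → ℝ} {g : ℝ → ℝ} {μ δ lam t u : ℝ}

theorem IsAmenable.deriv_nonneg (h : IsAmenable ρ g μ) (hlam : 0 < lam) (ht : 0 < t) :
    0 ≤ deriv (fun u => ρ u lam) t := by
  have h1 := (h.mono lam hlam).derivWithin_nonneg (x := t)
  rwa [derivWithin_of_isOpen isOpen_Ioi ht] at h1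

/-- Weak convexity, read off the derivative. -/
theorem IsAmenable.deriv_add_le (h : IsAmenable ρ g μ) (hlam : 0 < lam) (ht : 0 < t)
    (htu : t ≤ u) :
    deriv (fun s => ρ s lam) t + μ * t ≤ deriv (fun s => ρ s lam) u + μ * u := by
  have key : ∀ s : ℝ, 0 < s → HasDerivAt (fun s => ρ s lam + μ / 2 * s ^ 2)
      (deriv (fun s => ρ s lam) s + μ * s) s := by
    intro s hs
    have h1 := (h.diff lam hlam s hs.ne').hasDerivAt
    have h2 := ((hasDerivAt_id s).pow 2).const_mul (μ / 2)
    convert! h1.add h2 using 1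
    simp only [id, Nat.cast_ofNat]
    ring
  have hc : ConvexOn ℝ (Set.Ioi 0) fun s => ρ s lam + μ / 2 * s ^ 2 :=
    (h.weak_convex lam hlam).subset (Set.subset_univ _) (convex_Ioi 0)
  have hm := hc.monotoneOn_deriv (fun s hs => (key s hs).differentiableAt)
  have := hm (Set.mem_Ioi.2 ht) (Set.mem_Ioi.2 (ht.trans_le htu)) htu
  rwa [(key t ht).deriv, (key u (ht.trans_le htu)).deriv] at this

theorem IsAmenable.level_le_deriv_add (h : IsAmenable ρ g μ) (hlam : 0 < lam) (ht : 0 < t) :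
    lam ≤ deriv (fun u => ρ u lam) t + μ * t := by
  have h1 : Tendsto (fun s => deriv (fun u => ρ u lam) s + μ * s) (𝓝[>] 0)
      (𝓝 (lam + μ * 0)) :=
    (h.deriv_zero lam hlam).add
      ((tendsto_id.const_mul μ).mono_left nhdsWithin_le_nhds)
  rw [mul_zero, add_zero] at h1
  refine le_of_tendsto h1 ?_
  filter_upwards [Ioo_mem_nhdsGT ht] with s hs
  exact h.deriv_add_le hlam hs.1 hs.2.le

/-- Below the flat region the derivative is at most `μ` times the distance to that region. -/
theorem IsFlatAmenable.deriv_le (h : IsFlatAmenable ρ g μ δ) (hlam : 0 < lam) (ht : 0 < t)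
    (htu : t ≤ δ * lam) : deriv (fun u => ρ u lam) t ≤ μ * (δ * lam - t) := by
  have h1 := h.deriv_add_le hlam ht htu
  rw [h.flat lam hlam _ le_rfl] at h1
  linarith

theorem IsFlatAmenable.level_le (h : IsFlatAmenable ρ g μ δ) (hδ : 0 < δ) (hlam : 0 < lam) :
    lam ≤ μ * (δ * lam) := by
  have h1 := h.level_le_deriv_add hlam (mul_pos hδ hlam)
  rw [h.flat lam hlam _ le_rfl] at h1
  linarith

end Penalty

/-! ### Norms -/

section Norms

variable {p J : ℕ} (grp : Fin p → Fin J)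

theorem l1Norm_nonneg (β : Vec p) : 0 ≤ l1Norm β := Finset.sum_nonneg fun _ _ => abs_nonneg _

theorem l1Norm_add_le (β β' : Vec p) : l1Norm (β + β') ≤ l1Norm β + l1Norm β' := by
  unfold l1Norm
  rw [← Finset.sum_add_distrib]
  exact Finset.sum_le_sum fun m _ => abs_add_le (β m) (β' m)

theorem l1Norm_smul (c : ℝ) (β : Vec p) : l1Norm (c • β) = |c| * l1Norm β := by
  simp [l1Norm, Finset.mul_sum, abs_mul]

theorem l1Norm_sub_le (β β' : Vec p) : l1Norm (β - β') ≤ l1Norm β + l1Norm β' := by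
  have := l1Norm_add_le β ((-1 : ℝ) • β')
  rw [l1Norm_smul] at this
  simpa [sub_eq_add_neg] using this

theorem norm_sq_eq_sum (β : Vec p) : ‖β‖ ^ 2 = ∑ m, β m ^ 2 := by
  rw [EuclideanSpace.norm_sq_eq]
  simp

theorem inner_eq_sum (β β' : Vec p) : inner ℝ β β' = ∑ m, β m * β' m := by
  simp [PiLp.inner_apply, mul_comm]

/-- Cauchy–Schwarz between the `ℓ₁` norm on a set of coordinates and the Euclidean norm. -/
theorem sum_abs_le_sqrt_card_mul_norm (I : Finset (Fin p)) (β : Vec p) :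
    ∑ m ∈ I, |β m| ≤ Real.sqrt I.card * ‖β‖ := by
  have h := Real.sum_mul_le_sqrt_mul_sqrt I (fun _ => (1 : ℝ)) (fun m => |β m|)
  simp only [one_mul, one_pow, Finset.sum_const, nsmul_eq_mul, mul_one, sq_abs] at h
  refine h.trans (mul_le_mul_of_nonneg_left ?_ (Real.sqrt_nonneg _))
  rw [← Real.sqrt_sq (norm_nonneg β), norm_sq_eq_sum]
  exact Real.sqrt_le_sqrt
    (Finset.sum_le_sum_of_subset_of_nonneg (Finset.subset_univ _) fun _ _ _ => sq_nonneg _)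

theorem l1Norm_le_of_support {I : Finset (Fin p)} {β : Vec p} (h : ∀ m ∉ I, β m = 0) :
    l1Norm β ≤ Real.sqrt I.card * ‖β‖ := by
  refine le_trans (le_of_eq ?_) (sum_abs_le_sqrt_card_mul_norm I β)
  exact (Finset.sum_subset (Finset.subset_univ I) fun m _ hm => by simp [h m hm]).symm

theorem sum_groupIndex (f : Fin p → ℝ) :
    ∑ j, ∑ m ∈ groupIndex grp j, f m = ∑ m, f m :=
  Finset.sum_fiberwise _ _ _

theorem groupNorm_nonneg (β : Vec p) (j : Fin J) : 0 ≤ groupNorm grp β j := Real.sqrt_nonneg _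

theorem groupNorm_sq (β : Vec p) (j : Fin J) :
    groupNorm grp β j ^ 2 = ∑ m ∈ groupIndex grp j, β m ^ 2 :=
  Real.sq_sqrt (Finset.sum_nonneg fun _ _ => sq_nonneg _)

theorem sum_groupNorm_sq (β : Vec p) : ∑ j, groupNorm grp β j ^ 2 = ‖β‖ ^ 2 := by
  simp_rw [groupNorm_sq]
  rw [sum_groupIndex, norm_sq_eq_sum]

theorem groupNorm_eq_zero {β : Vec p} {j : Fin J} (h : groupNorm grp β j = 0) {m : Fin p}
    (hm : m ∈ groupIndex grp j) : β m = 0 := by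
  have h1 := groupNorm_sq grp β j
  rw [h, eq_comm, zero_pow two_ne_zero,
    Finset.sum_eq_zero_iff_of_nonneg fun _ _ => sq_nonneg _] at h1
  exact pow_eq_zero_iff two_ne_zero |>.1 (h1 m hm)

theorem groupNorm_congr {β β' : Vec p} {j : Fin J} (h : ∀ m ∈ groupIndex grp j, β m = β' m) :
    groupNorm grp β j = groupNorm grp β' j := by
  unfold groupNorm
  rw [Finset.sum_congr rfl fun m hm => by rw [h m hm]]

theorem groupNorm_neg (β : Vec p) (j : Fin J) : groupNorm grp (-β) j = groupNorm grp β j := by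
  simp [groupNorm]

theorem sum_mul_le_groupNorm (β β' : Vec p) (j : Fin J) :
    ∑ m ∈ groupIndex grp j, β m * β' m ≤ groupNorm grp β j * groupNorm grp β' j :=
  Real.sum_mul_le_sqrt_mul_sqrt _ _ _

theorem groupNorm_add_le (β β' : Vec p) (j : Fin J) :
    groupNorm grp (β + β') j ≤ groupNorm grp β j + groupNorm grp β' j := by
  have hs : groupNorm grp (β + β') j ^ 2 ≤ (groupNorm grp β j + groupNorm grp β' j) ^ 2 := by
    have h1 : groupNorm grp (β + β') j ^ 2 = groupNorm grp β j ^ 2 +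
        2 * ∑ m ∈ groupIndex grp j, β m * β' m + groupNorm grp β' j ^ 2 := by
      simp_rw [groupNorm_sq, Finset.mul_sum, ← Finset.sum_add_distrib]
      refine Finset.sum_congr rfl fun m _ => ?_
      simp only [PiLp.add_apply]
      ring
    nlinarith [sum_mul_le_groupNorm grp β β' j]
  exact le_of_sq_le_sq hs (add_nonneg (groupNorm_nonneg _ _ _) (groupNorm_nonneg _ _ _))

theorem groupNorm_sub_le (β β' : Vec p) (j : Fin J) :
    groupNorm grp β j - groupNorm grp β' j ≤ groupNorm grp (β - β') j := by
  have := groupNorm_add_le grp (β - β') β' j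
  rw [sub_add_cancel] at this
  linarith

theorem groupNorm_sub_comm (β β' : Vec p) (j : Fin J) :
    groupNorm grp (β - β') j = groupNorm grp (β' - β) j := by
  rw [← groupNorm_neg, neg_sub]

theorem groupNorm_le_norm (β : Vec p) (j : Fin J) : groupNorm grp β j ≤ ‖β‖ := by
  refine le_of_sq_le_sq ?_ (norm_nonneg _)
  rw [← sum_groupNorm_sq grp]
  exact Finset.single_le_sum (f := fun j => groupNorm grp β j ^ 2) (fun _ _ => sq_nonneg _)
    (Finset.mem_univ j)

theorem groupNorm_le_l1Norm (β : Vec p) (j : Fin J) : groupNorm grp β j ≤ l1Norm β := by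
  refine le_of_sq_le_sq ?_ (l1Norm_nonneg _)
  rw [groupNorm_sq]
  calc ∑ m ∈ groupIndex grp j, β m ^ 2 ≤ ∑ m, |β m| ^ 2 := by
        simp_rw [sq_abs]
        exact Finset.sum_le_sum_of_subset_of_nonneg (Finset.subset_univ _)
          fun _ _ _ => sq_nonneg _
    _ ≤ (∑ m, |β m|) ^ 2 := Finset.sum_sq_le_sq_sum_of_nonneg fun _ _ => abs_nonneg _

theorem sum_abs_le_sqrt_groupSize_mul (β : Vec p) (j : Fin J) :
    ∑ m ∈ groupIndex grp j, |β m| ≤ Real.sqrt (groupSize grp j) * groupNorm grp β j := by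
  have h := Real.sum_mul_le_sqrt_mul_sqrt (groupIndex grp j) (fun _ => (1 : ℝ)) (fun m => |β m|)
  simp only [one_mul, one_pow, Finset.sum_const, nsmul_eq_mul, mul_one, sq_abs] at h
  exact h

theorem groupSize_pos (hgrp : Function.Surjective grp) (j : Fin J) : 0 < groupSize grp j := by
  obtain ⟨m, hm⟩ := hgrp j
  exact Finset.card_pos.2 ⟨m, by simp [groupIndex, hm]⟩

theorem groupSize_le_max (j : Fin J) : groupSize grp j ≤ maxGroupSize grp :=
  le_ciSup (Set.finite_range (groupSize grp)).bddAbove j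

theorem sum_mul_compl_groupSupport (S : Finset (Fin J)) (f : Fin p → ℝ) :
    ∑ j ∈ Sᶜ, ∑ m ∈ groupIndex grp j, f m = ∑ m ∈ (groupSupport grp S)ᶜ, f m := by
  have h : ∀ m ∈ (groupSupport grp S)ᶜ, grp m ∈ Sᶜ := by
    intro m hm
    simpa [groupSupport] using hm
  rw [← Finset.sum_fiberwise_of_maps_to h]
  refine Finset.sum_congr rfl fun j hj => Finset.sum_congr ?_ fun _ _ => rfl
  ext m
  simp only [groupIndex, groupSupport, Finset.mem_filter, Finset.mem_univ, true_and,
    Finset.mem_compl]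
  constructor
  · rintro rfl
    exact ⟨by simpa using hj, rfl⟩
  · exact fun h => h.2

end Norms

/-! ### Generalized gradients of the penalty -/

section PenaltyGradient

variable {p J : ℕ} {grp : Fin p → Fin J} {ρ : ℝ → ℝ → ℝ} {g : ℝ → ℝ} {μ δ lam : ℝ} {β ζ : Vec p}
  {j : Fin J}

theorem groupLevel_pos (hgrp : Function.Surjective grp) (hlam : 0 < lam) (j : Fin J) :
    0 < groupLevel grp lam j :=
  mul_pos (Real.sqrt_pos.2 (Nat.cast_pos.2 (groupSize_pos grp hgrp j))) hlam

/-- Towards a target deep in the flat region, the penalty pulls at most quadratically in the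
distance to the target. -/
theorem IsPenaltyGradient.sum_mul_sub_le_of_flat (hζ : IsPenaltyGradient ρ grp lam β ζ)
    (hρ : IsFlatAmenable ρ g μ δ) (hμ : 0 < μ) (hδ : 0 < δ) (hl : 0 < groupLevel grp lam j)
    {b : Vec p} (hb : 2 * (δ * groupLevel grp lam j) ≤ groupNorm grp b j) :
    ∑ m ∈ groupIndex grp j, ζ m * (b m - β m) ≤ μ / 2 * groupNorm grp (β - b) j ^ 2 := by
  have hpos : 0 < δ * groupLevel grp lam j := mul_pos hδ hl
  obtain ⟨h1, h2⟩ := hζ j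
  by_cases h0 : groupNorm grp β j = 0
  · have hz : ∀ m ∈ groupIndex grp j, (β - b) m = (-b) m := fun m hm => by
      simp [groupNorm_eq_zero grp h0 hm]
    rw [groupNorm_congr grp hz, groupNorm_neg]
    have hlev := hρ.level_le hδ hl
    calc ∑ m ∈ groupIndex grp j, ζ m * (b m - β m) = ∑ m ∈ groupIndex grp j, ζ m * b m :=
          Finset.sum_congr rfl fun m hm => by rw [groupNorm_eq_zero grp h0 hm, sub_zero]
      _ ≤ groupNorm grp ζ j * groupNorm grp b j := sum_mul_le_groupNorm grp ζ b j
      _ ≤ (μ / 2 * groupNorm grp b j) * groupNorm grp b j :=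
          mul_le_mul_of_nonneg_right (by nlinarith [h2 h0]) (groupNorm_nonneg _ _ _)
      _ = μ / 2 * groupNorm grp b j ^ 2 := by ring
  · have ht : 0 < groupNorm grp β j := (groupNorm_nonneg _ _ _).lt_of_ne' h0
    set t := groupNorm grp β j with htdef
    set D := deriv (fun t => ρ t (groupLevel grp lam j)) t with hD
    have hD0 : 0 ≤ D := hρ.deriv_nonneg hl ht
    have hsum : ∑ m ∈ groupIndex grp j, ζ m * (b m - β m) ≤ D * (groupNorm grp b j - t) := by
      have h3 : ∑ m ∈ groupIndex grp j, ζ m * (b m - β m)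
          = D / t * (∑ m ∈ groupIndex grp j, β m * b m - t ^ 2) := by
        rw [htdef, groupNorm_sq, ← htdef, ← Finset.sum_sub_distrib, Finset.mul_sum]
        refine Finset.sum_congr rfl fun m hm => ?_
        rw [h1 h0 m hm]
        ring
      have h4 := sum_mul_le_groupNorm grp β b j
      rw [← htdef] at h4
      calc ∑ m ∈ groupIndex grp j, ζ m * (b m - β m)
          ≤ D / t * (t * groupNorm grp b j - t ^ 2) := by
            rw [h3]
            exact mul_le_mul_of_nonneg_left (by linarith) (div_nonneg hD0 ht.le)
        _ = D * (groupNorm grp b j - t) := by field_simp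
    have hsub : groupNorm grp b j - t ≤ groupNorm grp (β - b) j := by
      rw [groupNorm_sub_comm]
      exact groupNorm_sub_le grp b β j
    refine hsum.trans ?_
    rcases le_total (δ * groupLevel grp lam j) t with hflat | hflat
    · rw [hD, hρ.flat _ hl t hflat, zero_mul]
      positivity
    · have h5 := hρ.deriv_le hl ht hflat
      -- the target is twice as far as the flat region begins, so half of the distance is to spare
      have h6 : D ≤ μ / 2 * (groupNorm grp b j - t) := by
        refine h5.trans ?_
        nlinarith
      have h7 : 0 ≤ groupNorm grp b j - t := by linarith
      calc D * (groupNorm grp b j - t)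
          ≤ μ / 2 * (groupNorm grp b j - t) * (groupNorm grp b j - t) :=
            mul_le_mul_of_nonneg_right h6 h7
        _ = μ / 2 * (groupNorm grp b j - t) ^ 2 := by ring
        _ ≤ _ := by gcongr

/-- Towards zero, the penalty pulls at least linearly, up to a quadratic term. -/
theorem IsPenaltyGradient.sum_mul_neg_le (hζ : IsPenaltyGradient ρ grp lam β ζ)
    (hρ : IsFlatAmenable ρ g μ δ) (hl : 0 < groupLevel grp lam j) :
    ∑ m ∈ groupIndex grp j, ζ m * (0 - β m) ≤
      μ / 2 * groupNorm grp β j ^ 2 - groupLevel grp lam j * groupNorm grp β j / 2 := by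
  by_cases h0 : groupNorm grp β j = 0
  · rw [h0]
    refine le_of_eq ?_
    rw [Finset.sum_eq_zero fun m hm => by rw [groupNorm_eq_zero grp h0 hm]; ring]
    ring
  · have ht : 0 < groupNorm grp β j := (groupNorm_nonneg _ _ _).lt_of_ne' h0
    obtain ⟨h1, -⟩ := hζ j
    set t := groupNorm grp β j with htdef
    set D := deriv (fun t => ρ t (groupLevel grp lam j)) t with hD
    have hD0 : 0 ≤ D := hρ.deriv_nonneg hl ht
    have hD1 : groupLevel grp lam j ≤ D + μ * t := hρ.level_le_deriv_add hl ht
    have h3 : ∑ m ∈ groupIndex grp j, ζ m * (0 - β m) = - (D / t * t ^ 2) := by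
      rw [htdef, groupNorm_sq, ← htdef, Finset.mul_sum, ← Finset.sum_neg_distrib]
      refine Finset.sum_congr rfl fun m hm => ?_
      rw [h1 h0 m hm]
      ring
    have h4 : D / t * t ^ 2 = D * t := by field_simp
    rw [h3, h4]
    nlinarith

/-- Let `b` be supported on `I_S` and deep in the flat region on the groups of `S`. Moving from
`β` to `b`, the penalty gains the `ℓ₁` norm of `β` off `I_S`, up to a quadratic term. -/
theorem IsPenaltyGradient.inner_sub_le (hζ : IsPenaltyGradient ρ grp lam β ζ)
    (hρ : IsFlatAmenable ρ g μ δ) (hμ : 0 < μ) (hδ : 0 < δ) (hgrp : Function.Surjective grp)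
    (hlam : 0 < lam) {S : Finset (Fin J)} {b : Vec p}
    (hb : ∀ m ∉ groupSupport grp S, b m = 0)
    (hflat : ∀ j ∈ S, 2 * (δ * groupLevel grp lam j) ≤ groupNorm grp b j) :
    inner ℝ ζ (b - β) ≤
      μ / 2 * ‖β - b‖ ^ 2 - lam / 2 * ∑ m ∈ (groupSupport grp S)ᶜ, |(β - b) m| := by
  have hl := groupLevel_pos hgrp hlam
  have hb0 : ∀ j ∈ Sᶜ, ∀ m ∈ groupIndex grp j, b m = 0 := by
    intro j hj m hm
    refine hb m ?_
    simp only [groupIndex, Finset.mem_filter, Finset.mem_univ, true_and] at hm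
    subst hm
    simpa [groupSupport] using hj
  have h1 : ∀ j ∈ S, ∑ m ∈ groupIndex grp j, ζ m * (b m - β m) ≤
      μ / 2 * groupNorm grp (β - b) j ^ 2 := fun j hj =>
    hζ.sum_mul_sub_le_of_flat hρ hμ hδ (hl j) (hflat j hj)
  have h2 : ∀ j ∈ Sᶜ, ∑ m ∈ groupIndex grp j, ζ m * (b m - β m) ≤
      μ / 2 * groupNorm grp (β - b) j ^ 2
        - lam / 2 * ∑ m ∈ groupIndex grp j, |(β - b) m| := by
    intro j hj
    have hz : ∀ m ∈ groupIndex grp j, (β - b) m = β m := fun m hm => by simp [hb0 j hj m hm]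
    have hz' : ∑ m ∈ groupIndex grp j, |(β - b) m| = ∑ m ∈ groupIndex grp j, |β m| :=
      Finset.sum_congr rfl fun m hm => by rw [hz m hm]
    rw [groupNorm_congr grp hz, hz', Finset.sum_congr rfl fun m hm => by rw [hb0 j hj m hm]]
    have h3 := hζ.sum_mul_neg_le hρ (hl j)
    have h4 := sum_abs_le_sqrt_groupSize_mul grp β j
    have h5 : lam * ∑ m ∈ groupIndex grp j, |β m| ≤ groupLevel grp lam j * groupNorm grp β j := by
      calc lam * ∑ m ∈ groupIndex grp j, |β m|
          ≤ lam * (Real.sqrt (groupSize grp j) * groupNorm grp β j) :=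
            mul_le_mul_of_nonneg_left h4 hlam.le
        _ = _ := by unfold groupLevel; ring
    linarith
  rw [inner_eq_sum, ← sum_groupIndex grp, ← sum_groupNorm_sq grp (β - b),
    ← sum_mul_compl_groupSupport, ← Finset.sum_add_sum_compl S,
    ← Finset.sum_add_sum_compl S (fun j => groupNorm grp (β - b) j ^ 2)]
  have h6 := Finset.sum_le_sum h1
  have h7 := Finset.sum_le_sum h2
  simp only [Finset.sum_sub_distrib, ← Finset.mul_sum] at h6 h7
  simp only [PiLp.sub_apply] at h6 h7 ⊢
  linarith

end PenaltyGradient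

/-! ### The oracle estimator -/

section Oracle

variable {n p : ℕ} {L : Vec p → ℝ} {I : Finset (Fin p)} {βs b : Vec p} {γ τ r G : ℝ}

/-- First-order condition of the oracle program, whose constraint set is convex. -/
theorem IsOracle.inner_gradient_nonneg (h : IsOracle L I βs r b) (hL : Differentiable ℝ L)
    {β : Vec p} (hβ : ∀ m ∉ I, β m = 0) (hβr : ‖β - βs‖ ≤ r) :
    0 ≤ inner ℝ (gradient L b) (β - b) := by
  have hconv : Convex ℝ {β : Vec p | (∀ m ∉ I, β m = 0) ∧ ‖β - βs‖ ≤ r} := by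
    have h1 : Convex ℝ {β : Vec p | ∀ m ∉ I, β m = 0} := by
      intro x hx y hy s t _ _ _ m hm
      simp [hx m hm, hy m hm]
    have h2 : {β : Vec p | ‖β - βs‖ ≤ r} = Metric.closedBall βs r := by
      ext β
      simp [dist_eq_norm]
    have h3 : Convex ℝ {β : Vec p | ‖β - βs‖ ≤ r} := h2 ▸ convex_closedBall βs r
    exact h1.inter h3
  rw [inner_gradient_left]
  exact h.2.localize.hasFDerivWithinAt_nonneg (hL b).hasFDerivAt.hasFDerivWithinAt
    (sub_mem_posTangentConeAt_of_segment_subset (hconv.segment_subset h.1 ⟨hβ, hβr⟩))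

theorem exists_isOracle (hL : Continuous L) (hr : 0 ≤ r) (hβs : ∀ m ∉ I, βs m = 0) :
    ∃ b, IsOracle L I βs r b := by
  have hcomp : IsCompact {β : Vec p | (∀ m ∉ I, β m = 0) ∧ ‖β - βs‖ ≤ r} := by
    have h2 : {β : Vec p | ‖β - βs‖ ≤ r} = Metric.closedBall βs r := by
      ext β
      simp [dist_eq_norm]
    have h1 : IsClosed {β : Vec p | ∀ m ∉ I, β m = 0} := by
      simp only [Set.ofPred_forall]
      refine isClosed_iInter fun m => isClosed_iInter fun _ => ?_
      exact isClosed_eq (by fun_prop) continuous_const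
    have h3 : IsCompact {β : Vec p | ‖β - βs‖ ≤ r} := h2 ▸ isCompact_closedBall βs r
    exact h3.inter_left h1
  obtain ⟨b, hb, hmin⟩ := hcomp.exists_isMinOn ⟨βs, hβs, by simpa using hr⟩ hL.continuousOn
  exact ⟨b, hb, hmin⟩

/-- When `τ |I| log p / n ≤ γ / 2`, restricted strong convexity is strong convexity on the
coordinate subspace of `I`. -/
theorem RSC.inner_ge_of_support (h : RSC n L βs γ τ r) (hτ : 0 ≤ τ)
    (hI : τ * (Real.log p / n) * I.card ≤ γ / 2) {β₁ β₂ : Vec p} (h₁ : ‖β₁ - βs‖ ≤ r)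
    (h₂ : ‖β₂ - βs‖ ≤ r) (hsupp : ∀ m ∉ I, (β₁ - β₂) m = 0) :
    γ / 2 * ‖β₁ - β₂‖ ^ 2 ≤ inner ℝ (gradient L β₁ - gradient L β₂) (β₁ - β₂) := by
  refine le_trans ?_ (h β₁ β₂ h₁ h₂)
  have hc : 0 ≤ τ * (Real.log p / n) :=
    mul_nonneg hτ (div_nonneg (Real.log_natCast_nonneg p) (Nat.cast_nonneg n))
  have h3 : l1Norm (β₁ - β₂) ^ 2 ≤ I.card * ‖β₁ - β₂‖ ^ 2 := by
    calc l1Norm (β₁ - β₂) ^ 2 ≤ (Real.sqrt I.card * ‖β₁ - β₂‖) ^ 2 :=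
          pow_le_pow_left₀ (l1Norm_nonneg _) (l1Norm_le_of_support hsupp) 2
      _ = I.card * ‖β₁ - β₂‖ ^ 2 := by rw [mul_pow, Real.sq_sqrt (Nat.cast_nonneg _)]
  nlinarith [mul_le_mul_of_nonneg_left h3 hc, mul_le_mul_of_nonneg_right hI (sq_nonneg ‖β₁ - β₂‖)]

theorem IsOracle.unique (hL : Differentiable ℝ L) (hrsc : RSC n L βs γ τ r) (hγ : 0 < γ)
    (hτ : 0 ≤ τ) (hI : τ * (Real.log p / n) * I.card ≤ γ / 2) {b' : Vec p}
    (hb : IsOracle L I βs r b) (hb' : IsOracle L I βs r b') : b = b' := by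
  have h1 := hb.inner_gradient_nonneg hL hb'.1.1 hb'.1.2
  have h2 := hb'.inner_gradient_nonneg hL hb.1.1 hb.1.2
  have h3 := hrsc.inner_ge_of_support hτ hI hb.1.2 hb'.1.2
    (fun m hm => by simp [hb.1.1 m hm, hb'.1.1 m hm])
  rw [inner_sub_left] at h3
  rw [← neg_sub b b', inner_neg_right] at h1
  have h4 : ‖b - b'‖ ^ 2 ≤ 0 := by nlinarith
  have h5 : ‖b - b'‖ = 0 := pow_eq_zero_iff two_ne_zero |>.1 (le_antisymm h4 (sq_nonneg _))
  exact sub_eq_zero.1 (norm_eq_zero.1 h5)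

/-- The oracle estimation error, in terms of the gradient at the truth. -/
theorem IsOracle.norm_sub_le (hb : IsOracle L I βs r b) (hL : Differentiable ℝ L)
    (hrsc : RSC n L βs γ τ r) (hγ : 0 < γ) (hτ : 0 ≤ τ) (hr : 0 ≤ r)
    (hI : τ * (Real.log p / n) * I.card ≤ γ / 2) (hβs : ∀ m ∉ I, βs m = 0)
    (hG : ∀ m ∈ I, |gradient L βs m| ≤ G) (hG0 : 0 ≤ G) :
    ‖b - βs‖ ≤ 2 / γ * (Real.sqrt I.card * G) := by
  have hsupp : ∀ m ∉ I, (b - βs) m = 0 := fun m hm => by simp [hb.1.1 m hm, hβs m hm]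
  have h1 := hb.inner_gradient_nonneg hL hβs (by simpa using hr)
  have h3 := hrsc.inner_ge_of_support hτ hI hb.1.2 (by simpa using hr) hsupp
  rw [inner_sub_left] at h3
  rw [← neg_sub b βs, inner_neg_right] at h1
  have h4 : -inner ℝ (gradient L βs) (b - βs) ≤ G * (Real.sqrt I.card * ‖b - βs‖) := by
    refine le_trans ?_
      (mul_le_mul_of_nonneg_left (sum_abs_le_sqrt_card_mul_norm I (b - βs)) hG0)
    rw [inner_eq_sum, ← Finset.sum_neg_distrib, Finset.mul_sum,
      ← Finset.sum_subset (Finset.subset_univ I) fun m _ hm => by rw [hsupp m hm]; ring]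
    refine Finset.sum_le_sum fun m hm => ?_
    refine (neg_le_abs _).trans ?_
    rw [abs_mul]
    exact mul_le_mul_of_nonneg_right (hG m hm) (abs_nonneg _)
  rcases (norm_nonneg (b - βs)).eq_or_lt with h0 | h0
  · rw [← h0]
    positivity
  · have h5 : γ / 2 * ‖b - βs‖ ≤ Real.sqrt I.card * G := by
      refine le_of_mul_le_mul_right ?_ h0
      nlinarith
    calc ‖b - βs‖ = 2 / γ * (γ / 2 * ‖b - βs‖) := by field_simp
      _ ≤ _ := mul_le_mul_of_nonneg_left h5 (by positivity)

/-- At an oracle estimator interior to the ball, the gradient vanishes on `I`. -/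
theorem IsOracle.gradient_eq_zero (hb : IsOracle L I βs r b) (hL : Differentiable ℝ L)
    (hint : ‖b - βs‖ < r) {m : Fin p} (hm : m ∈ I) : gradient L b m = 0 := by
  have key : ∀ s : ℝ, |s| ≤ r - ‖b - βs‖ → 0 ≤ s * gradient L b m := by
    intro s hs
    have h := hb.inner_gradient_nonneg hL (β := b + EuclideanSpace.single m s) ?_ ?_
    · rw [add_sub_cancel_left, EuclideanSpace.inner_single_right] at h
      simpa using h
    · intro m' hm'
      have : m' ≠ m := fun h => hm' (h ▸ hm)
      simp [hb.1.1 m' hm', this]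
    · rw [add_sub_right_comm]
      refine (norm_add_le _ _).trans ?_
      rw [PiLp.norm_single, Real.norm_eq_abs]
      linarith
  have hpos : 0 < r - ‖b - βs‖ := sub_pos.2 hint
  have h1 := key (r - ‖b - βs‖) (abs_of_pos hpos).le
  have h2 := key (-(r - ‖b - βs‖)) (by rw [abs_neg, abs_of_pos hpos])
  have h3 := nonneg_of_mul_nonneg_right h1 hpos
  nlinarith

end Oracle

/-! ### Stationary points -/

section Stationary

variable {n p J : ℕ} {grp : Fin p → Fin J} {ρ : ℝ → ℝ → ℝ} {g : ℝ → ℝ} {μ δ lam R : ℝ}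
  {L : Vec p → ℝ} {βs b bO : Vec p} {γ τ r : ℝ}

/-- The `ℓ₁` ball is convex, so the local variational inequality holds globally. -/
theorem IsStationary.exists_inner_nonneg (h : IsStationary L ρ grp lam R b)
    {β : Vec p} (hβ : l1Norm β ≤ R) :
    ∃ ζ, IsPenaltyGradient ρ grp lam b ζ ∧ 0 ≤ inner ℝ (gradient L b + ζ) (β - b) := by
  obtain ⟨hb, ζ, hζ, hev⟩ := h
  refine ⟨ζ, hζ, ?_⟩
  have ht : Tendsto (fun t : ℝ => b + t • (β - b)) (𝓝[>] 0) (𝓝 b) := by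
    have : Tendsto (fun t : ℝ => b + t • (β - b)) (𝓝 0) (𝓝 (b + (0 : ℝ) • (β - b))) :=
      Continuous.tendsto (by fun_prop) 0
    rw [zero_smul, add_zero] at this
    exact this.mono_left nhdsWithin_le_nhds
  obtain ⟨t, ht1, ht2⟩ := ((ht.eventually hev).and (Ioo_mem_nhdsGT one_pos)).exists
  have hfeas : l1Norm (b + t • (β - b)) ≤ R := by
    have he : b + t • (β - b) = (1 - t) • b + t • β := by
      rw [smul_sub, sub_smul, one_smul]
      abel
    rw [he]
    refine (l1Norm_add_le _ _).trans ?_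
    rw [l1Norm_smul, l1Norm_smul, abs_of_pos ht2.1, abs_of_pos (sub_pos.2 ht2.2)]
    nlinarith [ht2.1, ht2.2]
  have h1 := ht1 hfeas
  rw [add_sub_cancel_left, inner_smul_right] at h1
  exact nonneg_of_mul_nonneg_right h1 ht2.1

/-- A stationary point in the ball equals a vector `bO` with the following properties: it is
feasible, supported on `I_S`, deep in the flat region of the penalty on the groups of `S`, and the
gradient of the loss at `bO` vanishes on `I_S` and is at most `lam / 8` elsewhere. -/
theorem IsStationary.eq_of_flat (hb : IsStationary L ρ grp lam R b)
    (hρ : IsFlatAmenable ρ g μ δ) (hμ : 0 < μ) (hδ : 0 < δ) (hμγ : 3 / 4 * μ < γ) (hτ : 0 ≤ τ)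
    (hgrp : Function.Surjective grp) (hlam : 0 < lam) (hrsc : RSC n L βs γ τ r)
    (hR : 8 * τ * R * (Real.log p / n) ≤ lam) {S : Finset (Fin J)}
    (hk : 9 * τ * (Real.log p / n) * (groupSupport grp S).card ≤ μ / 4)
    (hbr : ‖b - βs‖ ≤ r) (hOr : ‖bO - βs‖ ≤ r) (hOR : l1Norm bO ≤ R)
    (hOs : ∀ m ∉ groupSupport grp S, bO m = 0)
    (hflat : ∀ j ∈ S, 2 * (δ * groupLevel grp lam j) ≤ groupNorm grp bO j)
    (hO0 : ∀ m ∈ groupSupport grp S, gradient L bO m = 0)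
    (hO1 : ∀ m ∉ groupSupport grp S, |gradient L bO m| ≤ lam / 8) : b = bO := by
  obtain ⟨ζ, hζ, hst⟩ := hb.exists_inner_nonneg hOR
  have hpen := hζ.inner_sub_le hρ hμ hδ hgrp hlam hOs hflat
  have hR2 := hrsc b bO hbr hOr
  set I := groupSupport grp S with hI
  set N := ‖b - bO‖ with hN
  set A := ∑ m ∈ I, |(b - bO) m| with hA
  set B := ∑ m ∈ Iᶜ, |(b - bO) m| with hB
  have hc : 0 ≤ τ * (Real.log p / n) :=
    mul_nonneg hτ (div_nonneg (Real.log_natCast_nonneg p) (Nat.cast_nonneg n))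
  have hA0 : 0 ≤ A := Finset.sum_nonneg fun _ _ => abs_nonneg _
  have hB0 : 0 ≤ B := Finset.sum_nonneg fun _ _ => abs_nonneg _
  have hAB : l1Norm (b - bO) = A + B := (Finset.sum_add_sum_compl I _).symm
  have hgrad : -inner ℝ (gradient L bO) (b - bO) ≤ lam / 8 * B := by
    rw [inner_eq_sum, ← Finset.sum_neg_distrib, hB, Finset.mul_sum,
      ← Finset.sum_subset (Finset.subset_univ Iᶜ) fun m _ hm => by
        rw [hO0 m (by simpa using hm)]; ring]
    refine Finset.sum_le_sum fun m hm => (neg_le_abs _).trans ?_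
    rw [abs_mul]
    exact mul_le_mul_of_nonneg_right (hO1 m (by simpa using hm)) (abs_nonneg _)
  have hbasic : γ * N ^ 2 - τ * (Real.log p / n) * (A + B) ^ 2 ≤
      μ / 2 * N ^ 2 - 3 / 8 * lam * B := by
    rw [hAB, inner_sub_left] at hR2
    rw [inner_add_left, ← neg_sub b bO, inner_neg_right, neg_sub] at hst
    linarith
  -- The constraint `‖·‖₁ ≤ R` turns the tolerance into a linear term, which gives a cone condition.
  have hcone : B ≤ 2 * A := by
    have h2R : A + B ≤ 2 * R := by
      rw [← hAB]
      linarith [l1Norm_sub_le b bO, hb.1]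
    have h1 : τ * (Real.log p / n) * (A + B) ^ 2 ≤ lam / 4 * (A + B) := by
      have h2 : τ * (Real.log p / n) * (A + B) ≤ lam / 4 := by
        have := mul_le_mul_of_nonneg_left h2R hc
        linarith
      nlinarith
    have h3 : 0 ≤ (γ - μ / 2) * N ^ 2 := mul_nonneg (by linarith) (sq_nonneg _)
    nlinarith
  -- On the cone the tolerance is absorbed by the curvature.
  have htol : τ * (Real.log p / n) * (A + B) ^ 2 ≤ μ / 4 * N ^ 2 := by
    have h1 : A + B ≤ 3 * (Real.sqrt I.card * N) := by
      have := sum_abs_le_sqrt_card_mul_norm I (b - bO)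
      linarith
    have h2 : (A + B) ^ 2 ≤ 9 * (I.card * N ^ 2) := by
      calc (A + B) ^ 2 ≤ (3 * (Real.sqrt I.card * N)) ^ 2 :=
            pow_le_pow_left₀ (by positivity) h1 2
        _ = 9 * (Real.sqrt I.card ^ 2 * N ^ 2) := by ring
        _ = _ := by rw [Real.sq_sqrt (Nat.cast_nonneg _)]
    nlinarith [mul_le_mul_of_nonneg_left h2 hc, mul_le_mul_of_nonneg_right hk (sq_nonneg N)]
  have hfin : (γ - 3 / 4 * μ) * N ^ 2 ≤ 0 := by nlinarith [mul_nonneg hlam.le hB0]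
  have hN0 : N = 0 := by
    by_contra hne
    have : 0 < N ^ 2 := by positivity
    nlinarith
  exact sub_eq_zero.1 (norm_eq_zero.1 hN0)

end Stationary

/-! ### Exponential moments of squares -/

section Moments

variable {Ω : Type*} [MeasurableSpace Ω] {P : Measure Ω}

theorem integrable_and_integral_le_of_lintegral_le {f : Ω → ℝ} {B : ℝ} (hf : Measurable f)
    (hf0 : ∀ ω, 0 ≤ f ω) (hB : 0 ≤ B)
    (h : ∫⁻ ω, ENNReal.ofReal (f ω) ∂P ≤ ENNReal.ofReal B) :
    Integrable f P ∧ ∫ ω, f ω ∂P ≤ B := by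
  have hint : Integrable f P := by
    refine ⟨hf.aestronglyMeasurable, ?_⟩
    rw [hasFiniteIntegral_iff_ofReal (ae_of_all _ hf0)]
    exact h.trans_lt ENNReal.ofReal_lt_top
  refine ⟨hint, ?_⟩
  rw [← ofReal_integral_eq_lintegral_ofReal hint (ae_of_all _ hf0)] at h
  exact (ENNReal.ofReal_le_ofReal_iff hB).1 h

/-- Completing the square: `exp (s z²)` as a Gaussian average of exponentials of `z`. -/
theorem lintegral_exp_neg_sq_mul_exp {s : ℝ} (hs : 0 ≤ s) (z : ℝ) :
    ∫⁻ y : ℝ, ENNReal.ofReal (Real.exp (-y ^ 2) * Real.exp (2 * Real.sqrt s * y * z)) =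
      ENNReal.ofReal (Real.sqrt Real.pi * Real.exp (s * z ^ 2)) := by
  have hfun : (fun y : ℝ => Real.exp (-y ^ 2) * Real.exp (2 * Real.sqrt s * y * z)) =
      fun y => Real.exp (s * z ^ 2) * Real.exp (-1 * (y - Real.sqrt s * z) ^ 2) := by
    funext y
    rw [← Real.exp_add, ← Real.exp_add]
    congr 1
    nlinarith [Real.sq_sqrt hs]
  have hint : Integrable fun y : ℝ => Real.exp (-1 * (y - Real.sqrt s * z) ^ 2) :=
    (integrable_exp_neg_mul_sq one_pos).comp_sub_right (Real.sqrt s * z)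
  rw [← ofReal_integral_eq_lintegral_ofReal (by rw [hfun]; exact hint.const_mul _)
    (ae_of_all _ fun y => by positivity), hfun, integral_const_mul,
    integral_sub_right_eq_self (fun y : ℝ => Real.exp (-1 * y ^ 2)) (Real.sqrt s * z),
    integral_gaussian, div_one, mul_comm]

/-- The square of a sub-Gaussian variable has an exponential moment. -/
theorem exp_sq_of_hasSubgaussianMGF [IsProbabilityMeasure P] {X : Ω → ℝ} {c : NNReal}
    (h : HasSubgaussianMGF X c P) (hX : Measurable X) {s : ℝ} (hs : 0 ≤ s) (hsc : 4 * s * c ≤ 1) :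
    Integrable (fun ω => Real.exp (s * X ω ^ 2)) P ∧ ∫ ω, Real.exp (s * X ω ^ 2) ∂P ≤ 2 := by
  have hpi : 0 < Real.sqrt Real.pi := Real.sqrt_pos.2 Real.pi_pos
  have hmain : ∫⁻ ω, ENNReal.ofReal (Real.sqrt Real.pi * Real.exp (s * X ω ^ 2)) ∂P ≤
      ENNReal.ofReal (Real.sqrt Real.pi * 2) := by
    simp_rw [← lintegral_exp_neg_sq_mul_exp hs]
    rw [lintegral_lintegral_swap (by fun_prop)]
    have hy : ∀ y : ℝ,
        ∫⁻ ω, ENNReal.ofReal (Real.exp (-y ^ 2) * Real.exp (2 * Real.sqrt s * y * X ω)) ∂P ≤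
          ENNReal.ofReal (Real.exp (-(1 / 2) * y ^ 2)) := by
      intro y
      rw [← ofReal_integral_eq_lintegral_ofReal
        ((h.integrable_exp_mul _).const_mul _) (ae_of_all _ fun ω => by positivity),
        integral_const_mul]
      refine ENNReal.ofReal_le_ofReal ?_
      calc Real.exp (-y ^ 2) * ∫ ω, Real.exp (2 * Real.sqrt s * y * X ω) ∂P
          ≤ Real.exp (-y ^ 2) * Real.exp (c * (2 * Real.sqrt s * y) ^ 2 / 2) :=
            mul_le_mul_of_nonneg_left (h.mgf_le _) (Real.exp_pos _).le
        _ = Real.exp (-y ^ 2 + 2 * s * c * y ^ 2) := by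
            rw [← Real.exp_add, mul_pow, mul_pow, Real.sq_sqrt hs]
            ring_nf
        _ ≤ Real.exp (-(1 / 2) * y ^ 2) := by
            refine Real.exp_le_exp.2 ?_
            nlinarith [mul_le_mul_of_nonneg_right hsc (sq_nonneg y)]
    refine (lintegral_mono hy).trans ?_
    rw [← ofReal_integral_eq_lintegral_ofReal (integrable_exp_neg_mul_sq (by norm_num))
      (ae_of_all _ fun y => (Real.exp_pos _).le), integral_gaussian]
    refine ENNReal.ofReal_le_ofReal ?_
    rw [show Real.pi / (1 / 2) = Real.pi * 2 by ring, Real.sqrt_mul Real.pi_pos.le]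
    refine mul_le_mul_of_nonneg_left ?_ hpi.le
    exact Real.sqrt_le_iff.2 ⟨by norm_num, by norm_num⟩
  obtain ⟨h1, h2⟩ := integrable_and_integral_le_of_lintegral_le (by fun_prop)
    (fun ω => by positivity) (by positivity) hmain
  rw [integral_const_mul] at h2
  refine ⟨?_, le_of_mul_le_mul_left h2 hpi⟩
  simpa [hpi.ne', ← mul_assoc] using h1.const_mul (Real.sqrt Real.pi)⁻¹

/-- The exponential moment of the square, for a sub-Gaussian variable with a bounded mean. -/
theorem IsSubGaussian.exp_sq [IsProbabilityMeasure P] {Z : Ω → ℝ} {σ2 M : ℝ}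
    (h : IsSubGaussian P Z σ2) (hZ : Measurable Z) (hσ : 0 < σ2)
    (hM : |∫ ω, Z ω ∂P| ≤ M) :
    Integrable (fun ω => Real.exp (1 / (8 * σ2) * Z ω ^ 2)) P ∧
      ∫ ω, Real.exp (1 / (8 * σ2) * Z ω ^ 2) ∂P ≤ Real.exp (1 + M ^ 2 / (4 * σ2)) := by
  set z := ∫ ω, Z ω ∂P with hz
  obtain ⟨h1, h2⟩ := exp_sq_of_hasSubgaussianMGF (s := 1 / (4 * σ2)) h (by fun_prop) (by positivity)
    (by rw [Real.coe_toNNReal _ hσ.le]; field_simp; norm_num)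
  have hle : ∀ ω, Real.exp (1 / (8 * σ2) * Z ω ^ 2) ≤
      Real.exp (M ^ 2 / (4 * σ2)) * Real.exp (1 / (4 * σ2) * (Z ω - z) ^ 2) := by
    intro ω
    rw [← Real.exp_add]
    refine Real.exp_le_exp.2 ?_
    have hz2 : z ^ 2 ≤ M ^ 2 := by
      rw [← sq_abs z]
      exact pow_le_pow_left₀ (abs_nonneg z) hM 2
    have h3 : Z ω ^ 2 ≤ 2 * (Z ω - z) ^ 2 + 2 * M ^ 2 := by nlinarith [sq_nonneg (Z ω - 2 * z)]
    calc 1 / (8 * σ2) * Z ω ^ 2 ≤ 1 / (8 * σ2) * (2 * (Z ω - z) ^ 2 + 2 * M ^ 2) :=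
          mul_le_mul_of_nonneg_left h3 (by positivity)
      _ = _ := by field_simp; ring
  have hint : Integrable (fun ω => Real.exp (1 / (8 * σ2) * Z ω ^ 2)) P := by
    refine (h1.const_mul (Real.exp (M ^ 2 / (4 * σ2)))).mono'
      (by fun_prop) (ae_of_all _ fun ω => ?_)
    rw [Real.norm_eq_abs, Real.abs_exp]
    exact hle ω
  refine ⟨hint, (integral_mono hint (h1.const_mul _) hle).trans ?_⟩
  rw [integral_const_mul, mul_comm, Real.exp_add]
  refine mul_le_mul_of_nonneg_right (h2.trans ?_) (Real.exp_pos _).le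
  linarith [Real.add_one_le_exp 1]

theorem exp_le_add_exp_sq (x : ℝ) : Real.exp x ≤ x + Real.exp (x ^ 2) := by
  have h1 := Real.add_one_le_exp (x ^ 2)
  rcases le_total |x| 1 with hx | hx
  · have := le_of_abs_le (Real.abs_exp_sub_one_sub_id_le hx)
    linarith
  · rcases le_abs'.1 hx with hx | hx
    · have : Real.exp x ≤ 1 := Real.exp_le_one_iff.2 (by linarith)
      nlinarith
    · have : Real.exp x ≤ Real.exp (x ^ 2) := Real.exp_le_exp.2 (by nlinarith)
      linarith

/-- A centred variable whose square has an exponential moment is sub-Gaussian. -/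
theorem hasSubgaussianMGF_of_exp_sq [IsProbabilityMeasure P] {X : Ω → ℝ} {s B : ℝ}
    (hX : Measurable X) (hXi : Integrable X P) (hX0 : ∫ ω, X ω ∂P = 0) (hs : 0 < s)
    (hint : Integrable (fun ω => Real.exp (s * X ω ^ 2)) P)
    (hB : ∫ ω, Real.exp (s * X ω ^ 2) ∂P ≤ B) :
    HasSubgaussianMGF X (Real.toNNReal (2 * B / s)) P := by
  have hB1 : 1 ≤ B := by
    refine le_trans ?_ hB
    have := integral_mono (μ := P) (integrable_const (1 : ℝ)) hint
      (fun ω => Real.one_le_exp (by positivity))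
    simpa using this
  have hlarge : ∀ t ω, Real.exp (t * X ω) ≤
      Real.exp (t ^ 2 / s) * Real.exp (s * X ω ^ 2) := by
    intro t ω
    rw [← Real.exp_add]
    refine Real.exp_le_exp.2 ?_
    have h1 : t ^ 2 / s + s * X ω ^ 2 - t * X ω =
        ((t - s * X ω / 2) ^ 2 + 3 / 4 * (s * X ω) ^ 2) / s := by
      field_simp
      ring
    have h2 : 0 ≤ ((t - s * X ω / 2) ^ 2 + 3 / 4 * (s * X ω) ^ 2) / s := by positivity
    linarith
  have hexp : ∀ t : ℝ, Integrable (fun ω => Real.exp (t * X ω)) P := by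
    intro t
    refine (hint.const_mul (Real.exp (t ^ 2 / s))).mono' (by fun_prop) (ae_of_all _ fun ω => ?_)
    rw [Real.norm_eq_abs, Real.abs_exp]
    exact hlarge t ω
  refine ⟨hexp, fun t => ?_⟩
  rw [Real.coe_toNNReal _ (by positivity),
    show 2 * B / s * t ^ 2 / 2 = t ^ 2 / s + t ^ 2 / s * (B - 1) by ring]
  set u := t ^ 2 / s with hu
  have hu0 : 0 ≤ u := by positivity
  rcases le_total u 1 with hu1 | hu1
  · have hsmall : ∀ ω, Real.exp (t * X ω) ≤
        t * X ω + ((1 - u) + u * Real.exp (s * X ω ^ 2)) := by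
      intro ω
      refine (exp_le_add_exp_sq _).trans (add_le_add le_rfl ?_)
      have h := convexOn_exp.2 (Set.mem_univ 0) (Set.mem_univ (s * X ω ^ 2))
        (sub_nonneg.2 hu1) hu0 (by ring)
      simp only [smul_eq_mul, mul_zero, zero_add, Real.exp_zero, mul_one] at h
      have he : (t * X ω) ^ 2 = u * (s * X ω ^ 2) := by
        rw [hu]
        field_simp
      rwa [he]
    have h1 : ∫ ω, Real.exp (t * X ω) ∂P ≤ (1 - u) + u * B := by
      refine (integral_mono (hexp t) ((hXi.const_mul t).add
        ((integrable_const (1 - u)).add (hint.const_mul u))) hsmall).trans ?_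
      rw [integral_add' (hXi.const_mul t) ((integrable_const (1 - u)).add (hint.const_mul u)),
        integral_add' (integrable_const (1 - u)) (hint.const_mul u), integral_const_mul,
        integral_const_mul, hX0]
      simp only [mul_zero, integral_const, probReal_univ, smul_eq_mul, one_mul, zero_add]
      gcongr
    calc mgf X P t ≤ u * (B - 1) + 1 := by
          unfold mgf
          linarith
      _ ≤ Real.exp (u * (B - 1)) := Real.add_one_le_exp _
      _ ≤ _ := Real.exp_le_exp.2 (by linarith)
  · calc mgf X P t ≤ ∫ ω, Real.exp u * Real.exp (s * X ω ^ 2) ∂P :=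
          integral_mono (hexp t) (hint.const_mul _) (hlarge t)
      _ = Real.exp u * ∫ ω, Real.exp (s * X ω ^ 2) ∂P := integral_const_mul _ _
      _ ≤ Real.exp u * Real.exp (B - 1) := by
          refine mul_le_mul_of_nonneg_left ?_ (Real.exp_pos _).le
          have := Real.add_one_le_exp (B - 1)
          linarith
      _ = Real.exp (u + (B - 1)) := (Real.exp_add _ _).symm
      _ ≤ _ := Real.exp_le_exp.2 (by nlinarith)

/-! ### Concentration of empirical means -/

/-- Chernoff bound for an empirical mean. -/
theorem measureReal_sum_ge_le_of_exp_moment {n : ℕ} [IsProbabilityMeasure P] {Y : Fin n → Ω → ℝ}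
    (hY : ∀ i, Measurable (Y i)) (hind : iIndepFun Y P) {s B C : ℝ} (hs : 0 ≤ s)
    (hint : ∀ i, Integrable (fun ω => Real.exp (s * Y i ω)) P)
    (hB : ∀ i, ∫ ω, Real.exp (s * Y i ω) ∂P ≤ Real.exp B) :
    P.real {ω | n * C ≤ ∑ i, Y i ω} ≤ Real.exp (-(n * (s * C - B))) := by
  have h := measure_ge_le_exp_mul_mgf (μ := P) (X := ∑ i, Y i) (n * C) hs
    (hind.integrable_exp_mul_sum hY fun i _ => hint i)
  rw [hind.mgf_sum hY] at h
  simp only [Finset.sum_apply] at h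
  refine h.trans ?_
  have h2 : ∏ i, mgf (Y i) P s ≤ Real.exp B ^ n := by
    calc ∏ i, mgf (Y i) P s ≤ ∏ _i : Fin n, Real.exp B :=
          Finset.prod_le_prod (fun i _ => mgf_nonneg) fun i _ => hB i
      _ = Real.exp B ^ n := by simp
  refine (mul_le_mul_of_nonneg_left h2 (Real.exp_pos _).le).trans (le_of_eq ?_)
  rw [← Real.exp_nat_mul, ← Real.exp_add]
  ring_nf

/-- Two-sided Hoeffding bound for an empirical mean. -/
theorem measureReal_abs_sum_ge_le {n : ℕ} [IsProbabilityMeasure P] {Y : Fin n → Ω → ℝ}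
    (hind : iIndepFun Y P) {c : NNReal} (hc : ∀ i, HasSubgaussianMGF (Y i) c P) {t : ℝ}
    (ht : 0 ≤ t) (hn : 0 < n) :
    P.real {ω | n * t ≤ |∑ i, Y i ω|} ≤ 2 * Real.exp (-(n * t ^ 2 / (2 * c))) := by
  have hsub : {ω | n * t ≤ |∑ i, Y i ω|} ⊆
      {ω | n * t ≤ ∑ i, Y i ω} ∪ {ω | n * t ≤ ∑ i, (-Y i) ω} := by
    intro ω hω
    simp only [Set.mem_ofPred_eq, Set.mem_union, Pi.neg_apply, Finset.sum_neg_distrib] at hω ⊢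
    exact le_abs.1 hω
  have hnt : 0 ≤ n * t := by positivity
  have h1 := HasSubgaussianMGF.measure_sum_ge_le_of_iIndepFun hind (c := fun _ => c)
    (s := Finset.univ) (fun i _ => hc i) hnt
  have hind' : iIndepFun (fun i => -Y i) P :=
    hind.comp (fun _ x => -x) fun _ => measurable_neg
  have h2 := HasSubgaussianMGF.measure_sum_ge_le_of_iIndepFun hind' (c := fun _ => c)
    (s := Finset.univ) (fun i _ => (hc i).neg) hnt
  have he : -(n * t) ^ 2 / (2 * ((∑ _i : Fin n, c : NNReal) : ℝ)) = -(n * t ^ 2 / (2 * c)) := by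
    have : (n : ℝ) ≠ 0 := by positivity
    simp only [Finset.sum_const, Finset.card_univ, Fintype.card_fin, nsmul_eq_mul,
      NNReal.coe_mul, NNReal.coe_natCast]
    rcases eq_or_ne (c : ℝ) 0 with h0 | h0
    · simp [h0]
    · field_simp
  rw [he] at h1 h2
  calc _ ≤ _ := measureReal_mono hsub
    _ ≤ _ := measureReal_union_le _ _
    _ ≤ _ := by rw [two_mul]; exact add_le_add h1 h2

end Moments

/-! ### The gradient of the empirical loss -/

section Gradient

variable {n p : ℕ} {w v : Vec p → ℝ} {l : ℝ → ℝ} {k₁ k₂ : ℝ} {x : Fin n → Vec p} {y : Fin n → ℝ}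

theorem hasGradientAt_empLoss (hl : Differentiable ℝ l) (hv : ∀ z, 0 < v z) (β : Vec p) :
    HasGradientAt (empLoss w v l x y)
      (-(1 / (n : ℝ)) •
        ∑ i, (w (x i) * deriv l ((y i - inner ℝ (x i) β) * v (x i))) • x i) β := by
  rw [hasGradientAt_iff_hasFDerivAt]
  have h1 : ∀ i, HasFDerivAt
      (fun β : Vec p => w (x i) / v (x i) * l ((y i - inner ℝ (x i) β) * v (x i)))
      ((w (x i) / v (x i)) • (deriv l ((y i - inner ℝ (x i) β) * v (x i))) •
        (v (x i)) • (-(innerSL ℝ (x i) : Vec p →L[ℝ] ℝ))) β := by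
    intro i
    have h2 : HasFDerivAt (fun β : Vec p => (y i - inner ℝ (x i) β) * v (x i))
        ((v (x i)) • (-(innerSL ℝ (x i) : Vec p →L[ℝ] ℝ))) β :=
      ((innerSL ℝ (x i) : Vec p →L[ℝ] ℝ).hasFDerivAt.const_sub (y i)).mul_const (v (x i))
    exact ((hl _).hasDerivAt.comp_hasFDerivAt β h2).const_mul _
  have h3 := (HasFDerivAt.fun_sum fun i (_ : i ∈ Finset.univ) => h1 i).const_mul (1 / (n : ℝ))
  refine h3.congr_fderiv ?_
  ext u
  simp only [_root_.smul_apply, _root_.sum_apply,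
    _root_.neg_apply, innerSL_apply_apply, smul_eq_mul,
    InnerProductSpace.toDual_apply_apply, inner_smul_left, sum_inner, Finset.mul_sum]
  refine Finset.sum_congr rfl fun i _ => ?_
  have := (hv (x i)).ne'
  simp only [conj_trivial]
  field_simp

theorem differentiable_empLoss (hl : Differentiable ℝ l) (hv : ∀ z, 0 < v z) :
    Differentiable ℝ (empLoss w v l x y) :=
  fun β => (hasGradientAt_empLoss hl hv β).differentiableAt

theorem gradient_empLoss_apply (hl : Differentiable ℝ l) (hv : ∀ z, 0 < v z) (β : Vec p)
    (m : Fin p) :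
    gradient (empLoss w v l x y) β m =
      -(1 / (n : ℝ)) * ∑ i, w (x i) * x i m * deriv l (v (x i) * (y i - inner ℝ (x i) β)) := by
  rw [(hasGradientAt_empLoss hl hv β).gradient]
  simp only [PiLp.smul_apply, smul_eq_mul, WithLp.ofLp_sum, Finset.sum_apply]
  congr 1
  refine Finset.sum_congr rfl fun i _ => ?_
  rw [mul_comm (v (x i))]
  ring

/-- Bounded empirical second moments of the weighted design make the coordinates of the gradient
Lipschitz for the `ℓ₁` norm. -/
theorem abs_gradient_empLoss_sub_le (hl : IsRobustLoss l k₁ k₂) (hk₂ : 0 ≤ k₂)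
    (hv : ∀ z, 0 < v z) {B : ℝ} (hn : 0 < n) (hw2 : ∀ m, ∑ i, (w (x i) * x i m) ^ 2 ≤ n * B)
    (hv2 : ∀ m, ∑ i, (v (x i) * x i m) ^ 2 ≤ n * B) (β β' : Vec p) (m : Fin p) :
    |gradient (empLoss w v l x y) β m - gradient (empLoss w v l x y) β' m| ≤
      k₂ * B * l1Norm (β - β') := by
  have hn' : (0 : ℝ) < n := Nat.cast_pos.2 hn
  rw [gradient_empLoss_apply hl.diff hv, gradient_empLoss_apply hl.diff hv, ← mul_sub,
    ← Finset.sum_sub_distrib, abs_mul, abs_neg, abs_of_pos (by positivity)]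
  have hcross : ∀ m', ∑ i, |w (x i) * x i m| * |v (x i) * x i m'| ≤ n * B := by
    intro m'
    have h1 : ∀ i, |w (x i) * x i m| * |v (x i) * x i m'| ≤
        1 / 2 * (w (x i) * x i m) ^ 2 + 1 / 2 * (v (x i) * x i m') ^ 2 := by
      intro i
      rw [← sq_abs (w (x i) * x i m), ← sq_abs (v (x i) * x i m')]
      nlinarith [sq_nonneg (|w (x i) * x i m| - |v (x i) * x i m'|)]
    refine (Finset.sum_le_sum fun i _ => h1 i).trans ?_
    rw [Finset.sum_add_distrib, ← Finset.mul_sum, ← Finset.mul_sum]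
    linarith [hw2 m, hv2 m']
  have hterm : ∀ i, |w (x i) * x i m * deriv l (v (x i) * (y i - inner ℝ (x i) β)) -
      w (x i) * x i m * deriv l (v (x i) * (y i - inner ℝ (x i) β'))| ≤
        ∑ m', k₂ * |(β - β') m'| * (|w (x i) * x i m| * |v (x i) * x i m'|) := by
    intro i
    rw [← mul_sub, abs_mul]
    have h2 : |v (x i) * (y i - inner ℝ (x i) β) - v (x i) * (y i - inner ℝ (x i) β')| ≤
        ∑ m', |(β - β') m'| * |v (x i) * x i m'| := by
      have h3 : v (x i) * (y i - inner ℝ (x i) β) - v (x i) * (y i - inner ℝ (x i) β') =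
          ∑ m', -((β - β') m' * (v (x i) * x i m')) := by
        rw [inner_eq_sum, inner_eq_sum, ← mul_sub, sub_sub_sub_cancel_left,
          ← Finset.sum_sub_distrib, Finset.mul_sum]
        refine Finset.sum_congr rfl fun m' _ => ?_
        simp only [PiLp.sub_apply]
        ring
      rw [h3]
      refine (Finset.abs_sum_le_sum_abs _ _).trans (le_of_eq ?_)
      exact Finset.sum_congr rfl fun m' _ => by rw [abs_neg, abs_mul]
    calc _ ≤ |w (x i) * x i m| * (k₂ * ∑ m', |(β - β') m'| * |v (x i) * x i m'|) :=
          mul_le_mul_of_nonneg_left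
            ((hl.lipschitz _ _).trans (mul_le_mul_of_nonneg_left h2 hk₂)) (abs_nonneg _)
      _ = _ := by
          rw [Finset.mul_sum, Finset.mul_sum]
          exact Finset.sum_congr rfl fun m' _ => by ring
  calc _ ≤ 1 / (n : ℝ) * ∑ i, ∑ m',
        k₂ * |(β - β') m'| * (|w (x i) * x i m| * |v (x i) * x i m'|) := by
          refine mul_le_mul_of_nonneg_left ?_ (by positivity)
          exact (Finset.abs_sum_le_sum_abs _ _).trans (Finset.sum_le_sum fun i _ => hterm i)
    _ = 1 / (n : ℝ) * ∑ m', k₂ * |(β - β') m'| *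
          ∑ i, |w (x i) * x i m| * |v (x i) * x i m'| := by
          rw [Finset.sum_comm]
          simp_rw [Finset.mul_sum]
    _ ≤ 1 / (n : ℝ) * ∑ m', k₂ * |(β - β') m'| * (n * B) := by
          refine mul_le_mul_of_nonneg_left (Finset.sum_le_sum fun m' _ => ?_) (by positivity)
          exact mul_le_mul_of_nonneg_left (hcross m') (mul_nonneg hk₂ (abs_nonneg _))
    _ = k₂ * B * l1Norm (β - β') := by
          rw [← Finset.sum_mul, ← Finset.mul_sum]
          unfold l1Norm
          field_simp

end Gradient

/-! ### The score and the weighted design -/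

section Design

variable {Ω : Type*} [MeasurableSpace Ω] {P : Measure Ω} {p : ℕ}
  {w v : Vec p → ℝ} {l : ℝ → ℝ} {k₀ k₁ k₂ σ M : ℝ} {x : Ω → Vec p} {e : Ω → ℝ}

theorem DesignConditions.subG_w_coord (h : DesignConditions P w v l k₀ σ M x e) (m : Fin p) :
    IsSubGaussian P (fun ω => w (x ω) * x ω m) (k₀ ^ 2) := by
  have h1 := h.subG_w (EuclideanSpace.single m 1)
  simpa [EuclideanSpace.inner_single_right] using h1

variable [IsProbabilityMeasure P]

theorem IsSubGaussian.integrable {Z : Ω → ℝ} {σ2 : ℝ} (h : IsSubGaussian P Z σ2) :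
    Integrable Z P := by
  have h1 := (HasSubgaussianMGF.integrable h).add (integrable_const (∫ ω, Z ω ∂P))
  exact h1.congr (ae_of_all _ fun ω => by simp)

/-- Either alternative of the design conditions makes the score unbiased. -/
theorem DesignConditions.integral_score (h : DesignConditions P w v l k₀ σ M x e)
    (hl : IsRobustLoss l k₁ k₂) (hx : Measurable x) (he : Measurable e)
    (hind : IndepFun x e P) (hw : Measurable w) (hv : Measurable v) (m : Fin p) :
    Integrable (fun ω => w (x ω) * x ω m * deriv l (v (x ω) * e ω)) P ∧
      ∫ ω, w (x ω) * x ω m * deriv l (v (x ω) * e ω) ∂P = 0 := by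
  have hdl := measurable_deriv l
  have hWi := (h.subG_w_coord m).integrable
  have hgm : Measurable fun ω => deriv l (v (x ω) * e ω) := by fun_prop
  have hbd : ∀ ω, ‖deriv l (v (x ω) * e ω)‖ ≤ k₁ := fun ω => hl.bounded _
  have hprod : Integrable (fun ω => w (x ω) * x ω m * deriv l (v (x ω) * e ω)) P :=
    hWi.mul_bdd (c := k₁) hgm.aestronglyMeasurable (ae_of_all _ hbd)
  refine ⟨hprod, ?_⟩
  rcases h.unbiased with ⟨hv1, hmean⟩ | hcond
  · have hi : IndepFun (fun ω => w (x ω) * x ω m) (fun ω => deriv l (e ω)) P :=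
      hind.comp (φ := fun z => w z * z m) (ψ := deriv l) (by fun_prop) hdl
    simp_rw [hv1, one_mul]
    rw [hi.integral_fun_mul_eq_mul_integral
      hWi.aestronglyMeasurable (hdl.comp he).aestronglyMeasurable, hmean m, zero_mul]
  · have hle : MeasurableSpace.comap x inferInstance ≤ ‹MeasurableSpace Ω› := hx.comap_le
    have hsm : StronglyMeasurable[MeasurableSpace.comap x inferInstance]
        fun ω => w (x ω) * x ω m := by
      have h1 : Measurable fun z : Vec p => w z * z m := by fun_prop
      exact (h1.comp (comap_measurable x)).stronglyMeasurable
    have hgi : Integrable (fun ω => deriv l (v (x ω) * e ω)) P :=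
      (integrable_const k₁).mono' hgm.aestronglyMeasurable (ae_of_all _ hbd)
    have hpull := condExp_mul_of_stronglyMeasurable_left hsm hprod hgi
    rw [← integral_condExp hle]
    have hz : P[fun ω => w (x ω) * x ω m * deriv l (v (x ω) * e ω) |
        MeasurableSpace.comap x inferInstance] =ᵐ[P] 0 := by
      refine hpull.trans ?_
      filter_upwards [hcond] with ω hω
      simp [hω]
    rw [integral_congr_ae hz]
    simp

/-- Boundedness of `l'` passes the exponential moment of the weighted covariate to the score. -/
theorem DesignConditions.hasSubgaussianMGF_score (h : DesignConditions P w v l k₀ σ M x e)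
    (hl : IsRobustLoss l k₁ k₂) (hk₀ : 0 < k₀) (hk₁ : 0 < k₁) (hx : Measurable x)
    (he : Measurable e) (hind : IndepFun x e P) (hw : Measurable w) (hv : Measurable v)
    (m : Fin p) :
    HasSubgaussianMGF (fun ω => w (x ω) * x ω m * deriv l (v (x ω) * e ω))
      (Real.toNNReal (16 * k₀ ^ 2 * k₁ ^ 2 * Real.exp (1 + M ^ 2 / (4 * k₀ ^ 2)))) P := by
  have hdl := measurable_deriv l
  obtain ⟨hint, hmean⟩ := h.integral_score hl hx he hind hw hv m
  obtain ⟨h1, h2⟩ := (h.subG_w_coord m).exp_sq (by fun_prop) (by positivity) (h.mean_w_le m)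
  have hs : 0 < 1 / (8 * k₀ ^ 2 * k₁ ^ 2) := by positivity
  have hle : ∀ ω, Real.exp (1 / (8 * k₀ ^ 2 * k₁ ^ 2) *
      (w (x ω) * x ω m * deriv l (v (x ω) * e ω)) ^ 2) ≤
        Real.exp (1 / (8 * k₀ ^ 2) * (w (x ω) * x ω m) ^ 2) := by
    intro ω
    refine Real.exp_le_exp.2 ?_
    have h3 : deriv l (v (x ω) * e ω) ^ 2 ≤ k₁ ^ 2 := by
      rw [← sq_abs]
      exact pow_le_pow_left₀ (abs_nonneg _) (hl.bounded _) 2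
    calc _ = 1 / (8 * k₀ ^ 2 * k₁ ^ 2) * (w (x ω) * x ω m) ^ 2 *
          deriv l (v (x ω) * e ω) ^ 2 := by ring
      _ ≤ 1 / (8 * k₀ ^ 2 * k₁ ^ 2) * (w (x ω) * x ω m) ^ 2 * k₁ ^ 2 :=
          mul_le_mul_of_nonneg_left h3 (by positivity)
      _ = _ := by field_simp
  have hint' : Integrable (fun ω => Real.exp (1 / (8 * k₀ ^ 2 * k₁ ^ 2) *
      (w (x ω) * x ω m * deriv l (v (x ω) * e ω)) ^ 2)) P := by
    refine h1.mono' (by fun_prop) (ae_of_all _ fun ω => ?_)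
    rw [Real.norm_eq_abs, Real.abs_exp]
    exact hle ω
  have hfin := hasSubgaussianMGF_of_exp_sq (by fun_prop) hint hmean hs hint'
    ((integral_mono hint' h1 hle).trans h2)
  convert! hfin using 2
  field_simp
  norm_num

variable {n : ℕ} {X : Fin n → Ω → Vec p} {ε : Fin n → Ω → ℝ}

/-- The scale of the sub-Gaussian tail of the score: twice its variance proxy. -/
noncomputable def scoreScale (k₀ k₁ M : ℝ) : ℝ :=
  32 * k₀ ^ 2 * k₁ ^ 2 * Real.exp (1 + M ^ 2 / (4 * k₀ ^ 2))

/-- A high-probability bound on the empirical second moments of the weighted covariates. -/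
noncomputable def momentBound (k₀ σ M : ℝ) : ℝ :=
  8 * k₀ ^ 2 * (2 + M ^ 2 / (4 * k₀ ^ 2)) + 8 * σ ^ 2 * (2 + M ^ 2 / (4 * σ ^ 2))

theorem IsSample.measureReal_score_ge_le (hs : IsSample P X ε)
    (hd : ∀ i, DesignConditions P w v l k₀ σ M (X i) (ε i)) (hl : IsRobustLoss l k₁ k₂)
    (hk₀ : 0 < k₀) (hk₁ : 0 < k₁) (hw : Measurable w) (hv : Measurable v) (hn : 0 < n)
    (m : Fin p) {t : ℝ} (ht : 0 ≤ t) :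
    P.real {ω | n * t ≤ |∑ i, w (X i ω) * X i ω m * deriv l (v (X i ω) * ε i ω)|} ≤
      2 * Real.exp (-(n * t ^ 2 / scoreScale k₀ k₁ M)) := by
  have hdl := measurable_deriv l
  have hind : iIndepFun
      (fun i ω => w (X i ω) * X i ω m * deriv l (v (X i ω) * ε i ω)) P :=
    hs.indep.comp (fun _ z => w z.1 * z.1 m * deriv l (v z.1 * z.2)) fun _ => by fun_prop
  refine (measureReal_abs_sum_ge_le hind (fun i => (hd i).hasSubgaussianMGF_score hl hk₀ hk₁
    (hs.meas_X i) (hs.meas_ε i) (hs.indep_X_ε i) hw hv m) ht hn).trans (le_of_eq ?_)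
  rw [Real.coe_toNNReal _ (by positivity), scoreScale]
  ring_nf

theorem IsSample.measureReal_sum_sq_ge_le (hs : IsSample P X ε) {f : Vec p → ℝ}
    (hf : Measurable f) {s C : ℝ} (hσ : 0 < s)
    (hsub : ∀ i, IsSubGaussian P (fun ω => f (X i ω)) s)
    (hmean : ∀ i, |∫ ω, f (X i ω) ∂P| ≤ M) (hC : 8 * s * (2 + M ^ 2 / (4 * s)) ≤ C) :
    P.real {ω | n * C ≤ ∑ i, f (X i ω) ^ 2} ≤ Real.exp (-n) := by
  have hX := hs.meas_X
  have hind : iIndepFun (fun i ω => f (X i ω) ^ 2) P :=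
    hs.indep.comp (fun _ z => f z.1 ^ 2) fun _ => by fun_prop
  have hmom := fun i => (hsub i).exp_sq (by fun_prop) hσ (hmean i)
  refine (measureReal_sum_ge_le_of_exp_moment (fun i => by fun_prop) hind (by positivity)
    (fun i => (hmom i).1) fun i => (hmom i).2).trans (Real.exp_le_exp.2 ?_)
  have h1 : 2 + M ^ 2 / (4 * s) ≤ 1 / (8 * s) * C := by
    calc 2 + M ^ 2 / (4 * s) = 1 / (8 * s) * (8 * s * (2 + M ^ 2 / (4 * s))) := by field_simp
      _ ≤ _ := mul_le_mul_of_nonneg_left hC (by positivity)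
  have h2 : (0 : ℝ) ≤ n := Nat.cast_nonneg n
  nlinarith

/-- Outside an event of small probability, the score is small on `I`, moderate on every
coordinate, and the empirical second moments are bounded. -/
theorem IsSample.exists_event (hs : IsSample P X ε)
    (hd : ∀ i, DesignConditions P w v l k₀ σ M (X i) (ε i)) (hl : IsRobustLoss l k₁ k₂)
    (hk₀ : 0 < k₀) (hk₁ : 0 < k₁) (hσ : 0 < σ) (hw : Measurable w) (hv : Measurable v)
    (hn : 0 < n) (I : Finset (Fin p)) {t t' : ℝ} (ht : 0 ≤ t) (ht' : 0 ≤ t') :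
    ∃ E : Set Ω, MeasurableSet E ∧
      1 - (I.card * (2 * Real.exp (-(n * t ^ 2 / scoreScale k₀ k₁ M))) +
        p * (2 * Real.exp (-(n * t' ^ 2 / scoreScale k₀ k₁ M))) +
        p * (2 * Real.exp (-n))) ≤ P.real E ∧
      ∀ ω ∈ E,
        (∀ m ∈ I, |∑ i, w (X i ω) * X i ω m * deriv l (v (X i ω) * ε i ω)| ≤ n * t) ∧
        (∀ m, |∑ i, w (X i ω) * X i ω m * deriv l (v (X i ω) * ε i ω)| ≤ n * t') ∧
        (∀ m, ∑ i, (w (X i ω) * X i ω m) ^ 2 ≤ n * momentBound k₀ σ M) ∧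
        (∀ m, ∑ i, (v (X i ω) * X i ω m) ^ 2 ≤ n * momentBound k₀ σ M) := by
  have hdl := measurable_deriv l
  have hX := hs.meas_X
  have hε := hs.meas_ε
  let F (t : ℝ) (m : Fin p) : Set Ω :=
    {ω | n * t ≤ |∑ i, w (X i ω) * X i ω m * deriv l (v (X i ω) * ε i ω)|}
  let Gw (m : Fin p) : Set Ω := {ω | n * momentBound k₀ σ M ≤ ∑ i, (w (X i ω) * X i ω m) ^ 2}
  let Gv (m : Fin p) : Set Ω := {ω | n * momentBound k₀ σ M ≤ ∑ i, (v (X i ω) * X i ω m) ^ 2}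
  have hF : ∀ t m, MeasurableSet (F t m) := fun t m =>
    measurableSet_le measurable_const (by fun_prop)
  have hGw : ∀ m, MeasurableSet (Gw m) := fun m => measurableSet_le measurable_const (by fun_prop)
  have hGv : ∀ m, MeasurableSet (Gv m) := fun m => measurableSet_le measurable_const (by fun_prop)
  let U : Set Ω := (⋃ m ∈ I, F t m) ∪ (⋃ m ∈ (Finset.univ : Finset (Fin p)), F t' m) ∪
    (⋃ m ∈ (Finset.univ : Finset (Fin p)), Gw m ∪ Gv m)
  have hU : MeasurableSet U :=
    ((I.measurableSet_biUnion fun m _ => hF t m).union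
      (Finset.univ.measurableSet_biUnion fun m _ => hF t' m)).union
      (Finset.univ.measurableSet_biUnion fun m _ => (hGw m).union (hGv m))
  have hpF : ∀ t : ℝ, 0 ≤ t → ∀ m, P.real (F t m) ≤
      2 * Real.exp (-(n * t ^ 2 / scoreScale k₀ k₁ M)) := fun t ht m =>
    hs.measureReal_score_ge_le hd hl hk₀ hk₁ hw hv hn m ht
  have hpG : ∀ m, P.real (Gw m ∪ Gv m) ≤ 2 * Real.exp (-n) := by
    intro m
    have h1 : P.real (Gw m) ≤ Real.exp (-n) :=
      hs.measureReal_sum_sq_ge_le (f := fun z => w z * z m) (by fun_prop) (by positivity)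
        (fun i => (hd i).subG_w_coord m) (fun i => (hd i).mean_w_le m)
        (le_add_of_nonneg_right (by positivity))
    have h2 : P.real (Gv m) ≤ Real.exp (-n) :=
      hs.measureReal_sum_sq_ge_le (f := fun z => v z * z m) (by fun_prop) (by positivity)
        (fun i => (hd i).subG_v m) (fun i => (hd i).mean_v_le m)
        (le_add_of_nonneg_left (by positivity))
    linarith [measureReal_union_le (μ := P) (Gw m) (Gv m)]
  have hpU : P.real U ≤ I.card * (2 * Real.exp (-(n * t ^ 2 / scoreScale k₀ k₁ M))) +
      p * (2 * Real.exp (-(n * t' ^ 2 / scoreScale k₀ k₁ M))) + p * (2 * Real.exp (-n)) := by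
    refine (measureReal_union_le _ _).trans (add_le_add ((measureReal_union_le _ _).trans
      (add_le_add ?_ ?_)) ?_)
    · refine (measureReal_biUnion_finset_le _ _).trans
        ((Finset.sum_le_sum fun m _ => hpF t ht m).trans ?_)
      simp
    · refine (measureReal_biUnion_finset_le _ _).trans
        ((Finset.sum_le_sum fun m _ => hpF t' ht' m).trans ?_)
      simp
    · refine (measureReal_biUnion_finset_le _ _).trans
        ((Finset.sum_le_sum fun m _ => hpG m).trans ?_)
      simp
  refine ⟨Uᶜ, hU.compl, ?_, fun ω hω => ?_⟩
  · rw [measureReal_compl hU, probReal_univ]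
    linarith
  · simp only [U, Set.mem_compl_iff, Set.mem_union, Set.mem_iUnion, not_or, not_exists, F, Gw, Gv,
      Set.mem_ofPred_eq, Finset.mem_univ, exists_prop, not_and, not_le, true_implies, not_or] at hω
    obtain ⟨⟨h1, h2⟩, h3⟩ := hω
    refine ⟨fun m hm => ?_, fun m => ?_, fun m => ?_, fun m => ?_⟩
    · exact (h1 m hm).le
    · exact (h2 m).le
    · exact (h3 m).1.le
    · exact (h3 m).2.le

end Design

/-! ### The deterministic core -/

/-- The conclusion of the theorem for a fixed loss `L`, from bounds on its gradient. Here `a` plays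
the role of `√(log p / n)`, the bound on `I_S` is of order `a / |I_S|`, and `H` is an `ℓ₁`-Lipschitz
constant of the coordinates of the gradient. -/
theorem oracle_of_gradient_bounds {n p J : ℕ} {grp : Fin p → Fin J} {S : Finset (Fin J)}
    {βs : Vec p} {ρ : ℝ → ℝ → ℝ} {g : ℝ → ℝ} {lam R μ δ γ τ r a A A' H C₆ : ℝ} {L : Vec p → ℝ}
    (hμ : 0 < μ) (hδ : 0 < δ) (hγ : 0 < γ) (hτ : 0 < τ) (hr : 0 < r) (hμγ : 3 / 4 * μ < γ)
    (hgrp : Function.Surjective grp) (hS : S.Nonempty) (hβs : ∀ m, grp m ∉ S → βs m = 0)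
    (hρ : IsFlatAmenable ρ g μ δ) (ha : 0 < a) (hA : 0 ≤ A) (hH : 0 ≤ H) (hC₆ : 0 < C₆)
    (hlam : lam = C₆ * a) (hR : 8 * τ * R * (Real.log p / n) ≤ lam) (hβR : l1Norm βs ≤ R / 2)
    (hk₁ : τ * (Real.log p / n) * (groupSupport grp S).card ≤ γ / 2)
    (hk₂ : 9 * τ * (Real.log p / n) * (groupSupport grp S).card ≤ μ / 4)
    (har : 2 * A / γ * a < r) (hC : 8 * (A' + H * (2 * A / γ)) ≤ C₆)
    (hmin : ∀ j ∈ S,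
      (2 * A / γ + 2 * δ * C₆) * (Real.sqrt (maxGroupSize grp) * a) ≤ groupNorm grp βs j)
    (hL : Differentiable ℝ L)
    (hgS : ∀ m ∈ groupSupport grp S,
      |gradient L βs m| ≤ A * a / (groupSupport grp S).card)
    (hg : ∀ m, |gradient L βs m| ≤ A' * a)
    (hlip : ∀ β m, |gradient L β m - gradient L βs m| ≤ H * l1Norm (β - βs))
    (hrsc : RSC n L βs γ τ r) :
    ∃ bO : Vec p, IsOracle L (groupSupport grp S) βs r bO ∧
      (∀ b : Vec p, IsOracle L (groupSupport grp S) βs r b → b = bO) ∧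
      ∀ b : Vec p, IsStationary L ρ grp lam R b → ‖b - βs‖ ≤ r →
        (∀ m, m ∉ groupSupport grp S → b m = 0) ∧
        (∀ m ∈ groupSupport grp S, b m = bO m) := by
  set I := groupSupport grp S with hI
  obtain ⟨j₀, hj₀⟩ := hS
  have hβI : ∀ m ∉ I, βs m = 0 := fun m hm => hβs m (by simpa [hI, groupSupport] using hm)
  have hIpos : (1 : ℝ) ≤ I.card := by
    obtain ⟨m, hm⟩ := hgrp j₀
    exact Nat.one_le_cast.2 (Finset.card_pos.2 ⟨m, by simp [hI, groupSupport, hm, hj₀]⟩)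
  have hdpos : 1 ≤ Real.sqrt (maxGroupSize grp) := by
    rw [Real.one_le_sqrt]
    exact_mod_cast (groupSize_pos grp hgrp j₀).trans_le (groupSize_le_max grp j₀)
  have hlam0 : 0 < lam := hlam ▸ mul_pos hC₆ ha
  have hD : 0 ≤ 2 * A / γ := by positivity
  obtain ⟨bO, hbO⟩ := exists_isOracle (I := I) hL.continuous hr.le hβI
  refine ⟨bO, hbO, fun b hb => hb.unique hL hrsc hγ hτ.le hk₁ hbO, fun b hb hbr => ?_⟩
  have herr : Real.sqrt I.card * ‖bO - βs‖ ≤ 2 * A / γ * a := by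
    have h1 := hbO.norm_sub_le hL hrsc hγ hτ.le hr.le hk₁ hβI hgS (by positivity)
    calc Real.sqrt I.card * ‖bO - βs‖
        ≤ Real.sqrt I.card * (2 / γ * (Real.sqrt I.card * (A * a / I.card))) :=
          mul_le_mul_of_nonneg_left h1 (Real.sqrt_nonneg _)
      _ = 2 / γ * (Real.sqrt I.card ^ 2 * (A * a / I.card)) := by ring
      _ = 2 * A / γ * a := by
          rw [Real.sq_sqrt (by positivity)]
          field_simp
  have herr2 : ‖bO - βs‖ ≤ 2 * A / γ * a := by
    refine le_trans ?_ herr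
    exact le_mul_of_one_le_left (norm_nonneg _) (Real.one_le_sqrt.2 hIpos)
  have hl1 : l1Norm (bO - βs) ≤ 2 * A / γ * a :=
    (l1Norm_le_of_support fun m hm => by simp [hbO.1.1 m hm, hβI m hm]).trans herr
  have hda : a ≤ Real.sqrt (maxGroupSize grp) * a := le_mul_of_one_le_left ha.le hdpos
  -- The signal on one group of `S` already exceeds the `ℓ₁` error of the oracle estimator.
  have hfeas : l1Norm bO ≤ R := by
    have h1 : l1Norm bO ≤ l1Norm (bO - βs) + l1Norm βs := by
      simpa using l1Norm_add_le (bO - βs) βs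
    have h2 := (hmin j₀ hj₀).trans (groupNorm_le_l1Norm grp βs j₀)
    have h3 : 2 * A / γ * a ≤
        (2 * A / γ + 2 * δ * C₆) * (Real.sqrt (maxGroupSize grp) * a) :=
      mul_le_mul (le_add_of_nonneg_right (by positivity)) hda ha.le (by positivity)
    linarith
  have hflat : ∀ j ∈ S, 2 * (δ * groupLevel grp lam j) ≤ groupNorm grp bO j := by
    intro j hj
    have h1 := groupNorm_sub_le grp βs bO j
    rw [groupNorm_sub_comm] at h1
    have h2 := groupNorm_le_norm grp (bO - βs) j
    have h3 : Real.sqrt (groupSize grp j) ≤ Real.sqrt (maxGroupSize grp) :=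
      Real.sqrt_le_sqrt (Nat.cast_le.2 (groupSize_le_max grp j))
    have h4 : 2 * (δ * groupLevel grp lam j) ≤
        2 * δ * C₆ * (Real.sqrt (maxGroupSize grp) * a) := by
      calc 2 * (δ * groupLevel grp lam j)
          = 2 * δ * C₆ * (Real.sqrt (groupSize grp j) * a) := by
            rw [groupLevel, hlam]
            ring
        _ ≤ _ := by gcongr
    have h5 := mul_le_mul_of_nonneg_left hda hD
    linarith [hmin j hj]
  have hgO : ∀ m, |gradient L bO m| ≤ lam / 8 := by
    intro m
    have h1 : |gradient L bO m| ≤ |gradient L βs m| + |gradient L bO m - gradient L βs m| := by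
      simpa using abs_add_le (gradient L βs m) (gradient L bO m - gradient L βs m)
    have h2 := mul_le_mul_of_nonneg_left hl1 hH
    have h3 := mul_le_mul_of_nonneg_right hC ha.le
    linarith [hg m, hlip bO m]
  have hbeq : b = bO := hb.eq_of_flat hρ hμ hδ hμγ hτ.le hgrp hlam0 hrsc hR hk₂ hbr hbO.1.2 hfeas
    hbO.1.1 hflat (fun m hm => hbO.gradient_eq_zero hL (herr2.trans_lt har) hm)
    fun m _ => hgO m
  subst hbeq
  exact ⟨hbO.1.1, fun _ _ => rfl⟩

/-- The failure probability of `IsSample.exists_event` at the thresholds of the theorem. Here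
`k` is the number of active coefficients and `x = log p`. -/
theorem event_probability_le {k n K x V p : ℝ} (hk : 1 ≤ k) (hV : 0 < V) (hn : 0 < n)
    (hp : 0 < p) (hx : x = Real.log p) (hx0 : 0 ≤ x) (hkK : k ^ 2 * Real.log k ≤ K * x)
    (hnx : 2 * x ≤ n) :
    k * (2 * Real.exp (-(n * (Real.sqrt (V * (|K| + 1)) * Real.sqrt (x / n) / k) ^ 2 / V))) +
      p * (2 * Real.exp (-(n * (Real.sqrt (2 * V) * Real.sqrt (x / n)) ^ 2 / V))) +
      p * (2 * Real.exp (-n)) ≤ 6 * Real.exp (-1 * x / k ^ 2) := by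
  have hk0 : 0 < k := by linarith
  have hpe : p = Real.exp x := by rw [hx, Real.exp_log hp]
  have hk1 : x / k ^ 2 ≤ x := div_le_self hx0 (one_le_pow₀ hk)
  have h1 : k * Real.exp (-(n * (Real.sqrt (V * (|K| + 1)) * Real.sqrt (x / n) / k) ^ 2 / V)) ≤
      Real.exp (-1 * x / k ^ 2) := by
    have hlog : Real.log k ≤ |K| * (x / k ^ 2) := by
      have h2 : Real.log k ≤ K * x / k ^ 2 := by
        rw [le_div_iff₀ (by positivity)]
        linarith
      refine h2.trans ?_
      rw [mul_div_assoc]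
      exact mul_le_mul_of_nonneg_right (le_abs_self K) (by positivity)
    have he : n * (Real.sqrt (V * (|K| + 1)) * Real.sqrt (x / n) / k) ^ 2 / V =
        (|K| + 1) * (x / k ^ 2) := by
      rw [div_pow, mul_pow, Real.sq_sqrt (by positivity), Real.sq_sqrt (by positivity)]
      field_simp
    rw [he]
    nth_rewrite 1 [← Real.exp_log hk0]
    rw [← Real.exp_add]
    refine Real.exp_le_exp.2 ?_
    rw [neg_one_mul, neg_div]
    linarith
  have h2 : p * Real.exp (-(n * (Real.sqrt (2 * V) * Real.sqrt (x / n)) ^ 2 / V)) ≤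
      Real.exp (-1 * x / k ^ 2) := by
    have he : n * (Real.sqrt (2 * V) * Real.sqrt (x / n)) ^ 2 / V = 2 * x := by
      rw [mul_pow, Real.sq_sqrt (by positivity), Real.sq_sqrt (by positivity)]
      field_simp
    rw [he, hpe, ← Real.exp_add]
    refine Real.exp_le_exp.2 ?_
    rw [neg_one_mul, neg_div]
    linarith
  have h3 : p * Real.exp (-n) ≤ Real.exp (-1 * x / k ^ 2) := by
    rw [hpe, ← Real.exp_add]
    refine Real.exp_le_exp.2 ?_
    rw [neg_one_mul, neg_div]
    linarith
  linarith

end GroupM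

open GroupM in
theorem theorem2
    -- the quantities on which the constants may depend
    (k₀ k₁ k₂ σ M μ δ γ τ r K : ℝ)
    (hk₀ : 0 < k₀) (hk₁ : 0 < k₁) (hk₂ : 0 < k₂) (hσ : 0 < σ) (hμ : 0 < μ) (hδ : 0 < δ)
    (hγ : 0 < γ) (hτ : 0 < τ) (hr : 0 < r) (hμγ : 3 / 4 * μ < γ) :
    ∃ C₀ C₄ C₇ c₆ : ℝ, 0 < C₀ ∧ 0 < C₄ ∧ 0 < C₇ ∧ 0 < c₆ ∧
    ∀ C₆ : ℝ, c₆ ≤ C₆ → ∃ C₈ : ℝ, 0 < C₈ ∧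
    ∀ (n p J : ℕ) (grp : Fin p → Fin J) (S : Finset (Fin J)) (βs : Vec p)
      (ρ : ℝ → ℝ → ℝ) (g : ℝ → ℝ) (l : ℝ → ℝ) (w v : Vec p → ℝ) (lam R : ℝ)
      (Ω : Type*) [MeasurableSpace Ω] (P : Measure Ω) [IsProbabilityMeasure P]
      (X : Fin n → Ω → Vec p) (ε : Fin n → Ω → ℝ),
      0 < n →
      -- nonempty groups, and group sparsity of the true coefficient vector
      Function.Surjective grp → S.Nonempty → (∀ m, grp m ∉ S → βs m = 0) →
      -- penalty, loss and weights
      IsFlatAmenable ρ g μ δ → IsRobustLoss l k₁ k₂ →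
      Measurable w → Measurable v → (∀ z, 0 < w z) → (∀ z, 0 < v z) →
      -- random design and errors
      IsSample P X ε → (∀ i, DesignConditions P w v l k₀ σ M (X i) (ε i)) →
      -- sample size, sparsity, tuning parameter, radius, minimum group signal
      C₀ * (groupSupport grp S).card * Real.log p ≤ n →
      ((groupSupport grp S).card : ℝ) ^ 2 * Real.log (groupSupport grp S).card ≤
        K * Real.log p →
      lam = C₆ * Real.sqrt (Real.log p / n) →
      8 * τ * R * (Real.log p / n) ≤ lam →
      12 * (1 + 3 * g (sizeRatio grp)) * maxGroupSize grp * lam * S.card / (4 * γ - 3 * μ) < R →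
      l1Norm βs ≤ R / 2 →
      (∀ j ∈ S, C₈ * Real.sqrt (maxGroupSize grp * Real.log p / n) ≤ groupNorm grp βs j) →
      -- conclusion
      ∃ E : Set Ω, MeasurableSet E ∧
        1 - C₇ * Real.exp (-C₄ * Real.log p / ((groupSupport grp S).card : ℝ) ^ 2) ≤ P.real E ∧
        ∀ ω ∈ E, ∀ L : Vec p → ℝ,
          L = empLoss w v l (fun i => X i ω) (fun i => inner ℝ (X i ω) βs + ε i ω) →
          RSC n L βs γ τ r →
          ∃ bO : Vec p, IsOracle L (groupSupport grp S) βs r bO ∧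
            (∀ b : Vec p, IsOracle L (groupSupport grp S) βs r b → b = bO) ∧
            ∀ b : Vec p, IsStationary L ρ grp lam R b → ‖b - βs‖ ≤ r →
              (∀ m, m ∉ groupSupport grp S → b m = 0) ∧
              (∀ m ∈ groupSupport grp S, b m = bO m) := by
  set V := scoreScale k₀ k₁ M with hVdef
  have hV : 0 < V := by rw [hVdef, scoreScale]; positivity
  set B := momentBound k₀ σ M with hBdef
  have hB : 0 < B := by rw [hBdef, momentBound]; positivity
  set A := Real.sqrt (V * (|K| + 1)) with hAdef
  have hA : 0 < A := Real.sqrt_pos.2 (by positivity)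
  set A' := Real.sqrt (2 * V) with hA'def
  have hA' : 0 < A' := Real.sqrt_pos.2 (by positivity)
  refine ⟨2 + 36 * τ / μ + 2 * τ / γ + (2 * A / γ) ^ 2 / r ^ 2, 1, 6,
    8 * (A' + k₂ * B * (2 * A / γ)), by positivity, one_pos, by norm_num, by positivity,
    fun C₆ hC₆ => ⟨2 * A / γ + 2 * δ * C₆, ?_, ?_⟩⟩
  · have : 0 < C₆ := lt_of_lt_of_le (by positivity) hC₆
    positivity
  intro n p J grp S βs ρ g l w v lam R Ω _ P _ X ε hn hgrp hS hβs hρ hl hw hv _ hv0 hs hd hC₀ hkK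
    hlam hR _ hβR hmin
  have hC₆0 : 0 < C₆ := lt_of_lt_of_le (by positivity) hC₆
  set k : ℝ := ((groupSupport grp S).card : ℝ) with hk
  have hk1 : 1 ≤ k := by
    obtain ⟨j, hj⟩ := hS
    obtain ⟨m, hm⟩ := hgrp j
    exact Nat.one_le_cast.2 (Finset.card_pos.2 ⟨m, by simp [groupSupport, hm, hj]⟩)
  have hp0 : 0 < p := by
    obtain ⟨j, -⟩ := hS
    exact Fin.pos (hgrp j).choose
  have hn' : (0 : ℝ) < n := Nat.cast_pos.2 hn
  -- For `p = 1` the logarithm vanishes and the probability bound is non-positive.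
  rcases Nat.eq_or_lt_of_le (Nat.one_le_iff_ne_zero.2 hp0.ne') with hp1 | hp1
  · refine ⟨∅, MeasurableSet.empty, ?_, fun ω hω => absurd hω (Set.notMem_empty ω)⟩
    rw [← hp1]
    norm_num
  have hlog : 0 < Real.log p := Real.log_pos (by exact_mod_cast hp1)
  have hq : 0 < Real.log p / n := div_pos hlog hn'
  -- Each term of `C₀` yields one smallness condition on `k log p / n`.
  have hC₀' : 2 * (k * (Real.log p / n)) + 36 * τ / μ * (k * (Real.log p / n)) +
      2 * τ / γ * (k * (Real.log p / n)) +
      (2 * A / γ) ^ 2 / r ^ 2 * (k * (Real.log p / n)) ≤ 1 := by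
    have h1 : (2 + 36 * τ / μ + 2 * τ / γ + (2 * A / γ) ^ 2 / r ^ 2) * k * Real.log p / n ≤ 1 :=
      (div_le_one hn').2 hC₀
    refine le_trans (le_of_eq ?_) h1
    ring
  set q := Real.log p / n with hqdef
  have hkq : q ≤ k * q := le_mul_of_one_le_left hq.le hk1
  have hkq0 : 0 < k * q := hq.trans_le hkq
  have ht1 : 0 ≤ 36 * τ / μ * (k * q) := by positivity
  have ht2 : 0 ≤ 2 * τ / γ * (k * q) := by positivity
  have ht3 : 0 ≤ (2 * A / γ) ^ 2 / r ^ 2 * (k * q) := by positivity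
  have hnx : 2 * Real.log p ≤ n := by
    have h1 : 2 * q ≤ 1 := by linarith
    rw [hqdef, ← mul_div_assoc, div_le_one hn'] at h1
    exact h1
  have hcond1 : τ * q * k ≤ γ / 2 := by
    have h1 : 2 * τ / γ * (k * q) ≤ 1 := by linarith
    have h2 : τ * q * k = γ / 2 * (2 * τ / γ * (k * q)) := by field_simp
    rw [h2]
    exact mul_le_of_le_one_right (by positivity) h1
  have hcond2 : 9 * τ * q * k ≤ μ / 4 := by
    have h1 : 36 * τ / μ * (k * q) ≤ 1 := by linarith
    have h2 : 9 * τ * q * k = μ / 4 * (36 * τ / μ * (k * q)) := by field_simp; norm_num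
    rw [h2]
    exact mul_le_of_le_one_right (by positivity) h1
  have hcond3 : 2 * A / γ * Real.sqrt q < r := by
    refine lt_of_pow_lt_pow_left₀ 2 hr.le ?_
    rw [mul_pow, Real.sq_sqrt hq.le]
    have h1 : (2 * A / γ) ^ 2 / r ^ 2 * (k * q) < 1 := by linarith
    have h2 : (2 * A / γ) ^ 2 / r ^ 2 * q < 1 :=
      lt_of_le_of_lt (mul_le_mul_of_nonneg_left hkq (by positivity)) h1
    rwa [div_mul_eq_mul_div, div_lt_one (by positivity)] at h2
  obtain ⟨E, hE, hPE, hgood⟩ := hs.exists_event hd hl hk₀ hk₁ hσ hw hv hn (groupSupport grp S)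
    (t := A * Real.sqrt q / k) (t' := A' * Real.sqrt q) (by positivity) (by positivity)
  refine ⟨E, hE, ?_, ?_⟩
  · refine le_trans (sub_le_sub_left ?_ 1) hPE
    exact event_probability_le hk1 hV hn' (Nat.cast_pos.2 hp0) rfl hlog.le hkK hnx
  intro ω hω L hLdef hrsc
  obtain ⟨hS1, hS2, hw2, hv2⟩ := hgood ω hω
  subst hLdef
  have hgrad : ∀ m t, |∑ i, w (X i ω) * X i ω m * deriv l (v (X i ω) * ε i ω)| ≤ n * t →
      |gradient (empLoss w v l (fun i => X i ω) (fun i => inner ℝ (X i ω) βs + ε i ω)) βs m| ≤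
        t := by
    intro m t ht
    rw [gradient_empLoss_apply hl.diff hv0]
    simp only [add_sub_cancel_left]
    rw [abs_mul, abs_neg, abs_of_pos (by positivity), one_div, inv_mul_le_iff₀ hn']
    exact ht
  refine oracle_of_gradient_bounds (A := A) (A' := A') (H := k₂ * B) hμ hδ hγ hτ hr hμγ hgrp hS hβs
    hρ (Real.sqrt_pos.2 hq) hA.le (by positivity) hC₆0 hlam hR hβR hcond1 hcond2 hcond3 hC₆ ?_
    (differentiable_empLoss hl.diff hv0) (fun m hm => hgrad m _ (hS1 m hm))
    (fun m => hgrad m _ (hS2 m))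
    (fun β m => abs_gradient_empLoss_sub_le hl hk₂.le hv0 hn hw2 hv2 β βs m) hrsc
  intro j hj
  have h1 : Real.sqrt (maxGroupSize grp * Real.log p / n) =
      Real.sqrt (maxGroupSize grp) * Real.sqrt q := by
    rw [mul_div_assoc, Real.sqrt_mul (Nat.cast_nonneg _)]
  rw [← h1]
  exact hmin j hj
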